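/- Let $\mathbb K=\mathbb R$ or $\mathbb C$. For $n\ge 1$ let $\mathcal G(\mathbb R^n)=\mathcal E_M(\mathbb R^n)/\mathcal N(\mathbb R^n)$ be the (special) Colombeau algebra of $\mathbb K$-valued generalized functions. Here $\mathcal E_M(\mathbb R^n)$ is the algebra of families $(u_\varepsilon)_{\varepsilon\in(0,1]}$ of smooth functions $u_\varepsilon:\mathbb R^n\to\mathbb K$ such that for every compact $K\subset\mathbb R^n$ and every multi-index $\alpha$ there is $p\ge 0$ with $\sup_{x\in K}|\partial^\alpha u_\varepsilon(x)|=O(\varepsilon^{-p})$ as $\varepsilon\to 0$, and $\mathcal N(\mathbb R^n)$ is the ideal of the families such that for every compact $K$, every $\alpha$ and every $q\ge 0$ one has $\sup_{x\in K}|\partial^\alpha u_\varepsilon(x)|=O(\varepsilon^{q})$ as $\varepsilon\to 0$. Derivatives, the restriction of $u\in\mathcal G(\mathbb R^2)$ to the line $\{t=0\}$, and the superposition $f(u)$ with a smooth $f$ that is of at most polynomial growth together with all its derivatives, are defined on representatives. The sharp topology on $\mathcal G(\mathbb R^n)$ is the translation-invariant topology for which the sets $$V(K,m,p)=\Big\{u\in\mathcal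 G(\mathbb R^n): u \text{ has a representative with } \sup_{x\in K}\sup_{|\alpha|\le m}|\partial^\alpha u_\varepsilon(x)|=O(\varepsilon^{p})\ (\varepsilon\to 0)\Big\},$$ with $K\subset\mathbb R^n$ compact and $m,p\in\mathbb N_0$, form a base of neighbourhoods of zero. **Proposition.** Let $f:\mathbb K\to\mathbb K$ be smooth (in the real sense), of at most polynomial growth together with all its derivatives, globally Lipschitz continuous, and with $f(0)=0$. Then for all $a,b\in\mathcal G(\mathbb R)$ and $h\in\mathcal G(\mathbb R^2)$ there is exactly one $u\in\mathcal G(\mathbb R^2)$ such that $$\partial_t^2u-\partial_x^2u=f(u)+h \ \text{ in } \mathcal G(\mathbb R^2),\qquad u|_{\{t=0\}}=a,\quad \partial_tu|_{\{t=0\}}=b\ \text{ in } \mathcal G(\mathbb R).$$ Moreover, the solution map $(a,b,h)\mapsto u$ is continuous from $\mathcal G(\mathbb R)\times\mathcal G(\mathbb R)\times\mathcal G(\mathbb R^2)$ to $\mathcal G(\mathbb R^2)$, where all spaces carry their sharp topologies and the product carries the product topology. -/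

import Mathlib

open Filter Topology
open scoped ContDiff

namespace Colombeau

/-- The parameter set `(0,1]`. -/
abbrev Par : Type := Set.Ioc (0 : ℝ) 1

/-- The filter `ε → 0` on `(0,1]`. -/
def toZero : Filter Par := Filter.comap (fun ε : Par => (ε : ℝ)) (𝓝 0)

section Estimates

variable {E : Type*} [NormedAddCommGroup E] [NormedSpace ℝ E]
variable {F : Type*} [NormedAddCommGroup F] [NormedSpace ℝ F]
variable {G : Type*} [NormedAddCommGroup G] [NormedSpace ℝ G]
variable {H : Type*} [NormedAddCommGroup H] [NormedSpace ℝ H]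

/-- `SupO w K k n` says that the supremum over `x ∈ K` of the size of all derivatives of order `k`
of `w ε` at `x` is `O(ε ^ n)` as `ε → 0`. The derivatives of order `k` are collected in the
`k`-th Fréchet derivative; in finite dimension its norm is comparable (with constants that depend
only on `k` and the space) to the maximum of `|∂^α w ε x|` over the multi-indices `|α| = k`. -/
def SupO (w : Par → E → F) (K : Set E) (k : ℕ) (n : ℤ) : Prop :=
  ∃ C : ℝ, ∀ᶠ ε : Par in toZero, ∀ x ∈ K, ‖iteratedFDeriv ℝ k (w ε) x‖ ≤ C * (ε : ℝ) ^ n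

/-- The growth condition of moderate families: on each compact set each derivative is
`O(ε ^ (-p))` for some `p`. -/
def IsModerate (w : Par → E → F) : Prop :=
  ∀ K : Set E, IsCompact K → ∀ k : ℕ, ∃ p : ℕ, SupO w K k (-(p : ℤ))

/-- The growth condition of null families: on each compact set each derivative is
`O(ε ^ q)` for all `q`. -/
def IsNull (w : Par → E → F) : Prop :=
  ∀ K : Set E, IsCompact K → ∀ k : ℕ, ∀ q : ℕ, SupO w K k (q : ℤ)

/-- A smooth function that is of at most polynomial growth, together with all its derivatives. -/
structure PolyGrowth (g : F → G) : Prop where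
  smooth : ContDiff ℝ ∞ g
  growth : ∀ k : ℕ, ∃ (C : ℝ) (p : ℕ), ∀ y : F, ‖iteratedFDeriv ℝ k g y‖ ≤ C * (1 + ‖y‖) ^ p

theorem SupO.mono {w : Par → E → F} {K : Set E} {k : ℕ} {n m : ℤ} (h : SupO w K k n)
    (hm : m ≤ n) : SupO w K k m := by
  obtain ⟨C, hC⟩ := h
  refine ⟨|C|, hC.mono fun ε hε x hx => (hε x hx).trans ?_⟩
  have h0 : (0 : ℝ) < ε := ε.2.1
  calc C * (ε : ℝ) ^ n ≤ |C| * (ε : ℝ) ^ n := by gcongr; exact le_abs_self C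
    _ ≤ |C| * (ε : ℝ) ^ m := by
      gcongr 1
      exact zpow_le_zpow_right_of_le_one₀ h0 ε.2.2 hm

theorem SupO.congr_norm {w : Par → E → F} {w' : Par → E → G} {K : Set E} {k l : ℕ} {n : ℤ}
    (h : SupO w K k n)
    (hw : ∀ ε x, ‖iteratedFDeriv ℝ l (w' ε) x‖ = ‖iteratedFDeriv ℝ k (w ε) x‖) :
    SupO w' K l n := by
  obtain ⟨C, hC⟩ := h
  exact ⟨C, hC.mono fun ε hε x hx => (hw ε x).le.trans (hε x hx)⟩

theorem SupO.add {w w' : Par → E → F} {K : Set E} {k : ℕ} {n : ℤ}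
    (sw : ∀ ε, ContDiff ℝ ∞ (w ε)) (sw' : ∀ ε, ContDiff ℝ ∞ (w' ε))
    (h : SupO w K k n) (h' : SupO w' K k n) : SupO (fun ε x => w ε x + w' ε x) K k n := by
  obtain ⟨C, hC⟩ := h
  obtain ⟨C', hC'⟩ := h'
  refine ⟨C + C', (hC.and hC').mono fun ε hε x hx => ?_⟩
  have hk : (k : ℕ∞ω) ≤ ∞ := by exact_mod_cast le_top
  have : iteratedFDeriv ℝ k (fun x => w ε x + w' ε x) x
      = iteratedFDeriv ℝ k (w ε) x + iteratedFDeriv ℝ k (w' ε) x :=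
    iteratedFDeriv_add_apply (((sw ε).of_le hk).contDiffAt) (((sw' ε).of_le hk).contDiffAt)
  rw [this, add_mul]
  exact (norm_add_le _ _).trans (add_le_add (hε.1 x hx) (hε.2 x hx))

theorem SupO.neg {w : Par → E → F} {K : Set E} {k : ℕ} {n : ℤ} (h : SupO w K k n) :
    SupO (fun ε x => -(w ε x)) K k n := by
  refine h.congr_norm fun ε x => ?_
  have : iteratedFDeriv ℝ k (fun x => -(w ε x)) x = -iteratedFDeriv ℝ k (w ε) x :=
    iteratedFDeriv_neg_apply
  rw [this, norm_neg]

/-- A finite number of estimates hold with a common constant. -/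
theorem SupO.unif {w : Par → E → F} {K : Set E} {k : ℕ} {n : ℤ}
    (h : ∀ i ≤ k, SupO w K i n) :
    ∃ C : ℝ, 0 ≤ C ∧ ∀ᶠ ε : Par in toZero, ∀ i ≤ k, ∀ x ∈ K,
      ‖iteratedFDeriv ℝ i (w ε) x‖ ≤ C * (ε : ℝ) ^ n := by
  induction k with
  | zero =>
    obtain ⟨C, hC⟩ := h 0 le_rfl
    refine ⟨|C|, abs_nonneg C, hC.mono fun ε hε i hi x hx => ?_⟩
    obtain rfl : i = 0 := by omega
    have h0 : (0 : ℝ) < ε := ε.2.1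
    refine (hε x hx).trans ?_
    gcongr
    exact le_abs_self C
  | succ k ih =>
    obtain ⟨C, hC0, hC⟩ := ih fun i hi => h i (by omega)
    obtain ⟨C', hC'⟩ := h (k + 1) le_rfl
    refine ⟨max C C', le_max_of_le_left hC0, (hC.and hC').mono fun ε hε i hi x hx => ?_⟩
    have h0 : (0 : ℝ) < ε := ε.2.1
    rcases Nat.lt_or_ge k i with hki | hki
    · obtain rfl : i = k + 1 := by omega
      refine (hε.2 x hx).trans ?_
      gcongr
      exact le_max_right _ _
    · refine (hε.1 i hki x hx).trans ?_
      gcongr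
      exact le_max_left _ _

theorem IsModerate.unif {w : Par → E → F} (h : IsModerate w) {K : Set E} (hK : IsCompact K)
    (k : ℕ) : ∃ p : ℕ, ∀ i ≤ k, SupO w K i (-(p : ℤ)) := by
  induction k with
  | zero =>
    obtain ⟨p, hp⟩ := h K hK 0
    refine ⟨p, fun i hi => ?_⟩
    obtain rfl : i = 0 := by omega
    exact hp
  | succ k ih =>
    obtain ⟨p, hp⟩ := ih
    obtain ⟨q, hq⟩ := h K hK (k + 1)
    refine ⟨p + q, fun i hi => ?_⟩
    rcases Nat.lt_or_ge k i with hki | hki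
    · obtain rfl : i = k + 1 := by omega
      exact hq.mono (by push_cast; omega)
    · exact (hp i hki).mono (by push_cast; omega)

theorem SupO.bilinear (B : F →L[ℝ] G →L[ℝ] H) {w : Par → E → F} {w' : Par → E → G}
    (sw : ∀ ε, ContDiff ℝ ∞ (w ε)) (sw' : ∀ ε, ContDiff ℝ ∞ (w' ε))
    {K : Set E} {k : ℕ} {n m : ℤ}
    (h : ∀ i ≤ k, SupO w K i n) (h' : ∀ i ≤ k, SupO w' K i m) :
    SupO (fun ε x => B (w ε x) (w' ε x)) K k (n + m) := by
  obtain ⟨C, hC0, hC⟩ := SupO.unif h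
  obtain ⟨C', hC0', hC'⟩ := SupO.unif h'
  refine ⟨‖B‖ * ∑ i ∈ Finset.range (k + 1), (k.choose i : ℝ) * C * C',
    (hC.and hC').mono fun ε hε x hx => ?_⟩
  have h0 : (0 : ℝ) < ε := ε.2.1
  have hk : (k : ℕ∞ω) ≤ ∞ := by exact_mod_cast le_top
  refine (B.norm_iteratedFDeriv_le_of_bilinear (sw ε) (sw' ε) x hk).trans ?_
  rw [mul_assoc, Finset.sum_mul]
  refine mul_le_mul_of_nonneg_left (Finset.sum_le_sum fun i hi => ?_) (norm_nonneg B)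
  have hi' : i ≤ k := by have := Finset.mem_range.1 hi; omega
  rw [zpow_add₀ h0.ne']
  calc (k.choose i : ℝ) * ‖iteratedFDeriv ℝ i (w ε) x‖ * ‖iteratedFDeriv ℝ (k - i) (w' ε) x‖
      ≤ (k.choose i : ℝ) * (C * (ε : ℝ) ^ n) * (C' * (ε : ℝ) ^ m) := by
        gcongr
        · exact hε.1 i hi' x hx
        · exact hε.2 (k - i) (by omega) x hx
    _ = (k.choose i : ℝ) * C * C' * ((ε : ℝ) ^ n * (ε : ℝ) ^ m) := by ring

theorem IsModerate.add {w w' : Par → E → F}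
    (sw : ∀ ε, ContDiff ℝ ∞ (w ε)) (sw' : ∀ ε, ContDiff ℝ ∞ (w' ε))
    (h : IsModerate w) (h' : IsModerate w') : IsModerate (fun ε x => w ε x + w' ε x) := by
  intro K hK k
  obtain ⟨p, hp⟩ := h K hK k
  obtain ⟨q, hq⟩ := h' K hK k
  exact ⟨p + q, SupO.add sw sw' (hp.mono (by push_cast; omega)) (hq.mono (by push_cast; omega))⟩

theorem IsModerate.bilinear (B : F →L[ℝ] G →L[ℝ] H) {w : Par → E → F} {w' : Par → E → G}
    (sw : ∀ ε, ContDiff ℝ ∞ (w ε)) (sw' : ∀ ε, ContDiff ℝ ∞ (w' ε))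
    (h : IsModerate w) (h' : IsModerate w') : IsModerate (fun ε x => B (w ε x) (w' ε x)) := by
  intro K hK k
  obtain ⟨p, hp⟩ := h.unif hK k
  obtain ⟨q, hq⟩ := h'.unif hK k
  exact ⟨p + q, (SupO.bilinear B sw sw' hp hq).mono (by push_cast; omega)⟩

theorem IsModerate.const (c : F) : IsModerate (fun (_ : Par) (_ : E) => c) := by
  intro K hK k
  refine ⟨0, ‖c‖, Eventually.of_forall fun ε x _ => ?_⟩
  rcases Nat.eq_zero_or_pos k with rfl | hk
  · simp
  · rw [iteratedFDeriv_const_of_ne hk.ne']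
    simp

theorem IsNull.zero : IsNull (fun (_ : Par) (_ : E) => (0 : F)) := by
  intro K hK k q
  refine ⟨0, Eventually.of_forall fun ε x _ => ?_⟩
  have : iteratedFDeriv ℝ k (fun _ : E => (0 : F)) = 0 := iteratedFDeriv_fun_zero
  simp [this]

theorem IsNull.add {w w' : Par → E → F}
    (sw : ∀ ε, ContDiff ℝ ∞ (w ε)) (sw' : ∀ ε, ContDiff ℝ ∞ (w' ε))
    (h : IsNull w) (h' : IsNull w') : IsNull (fun ε x => w ε x + w' ε x) :=
  fun K hK k q => SupO.add sw sw' (h K hK k q) (h' K hK k q)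

theorem SupO.bilinear_null (B : F →L[ℝ] G →L[ℝ] H) {w : Par → E → F} {w' : Par → E → G}
    (sw : ∀ ε, ContDiff ℝ ∞ (w ε)) (sw' : ∀ ε, ContDiff ℝ ∞ (w' ε))
    {K : Set E} (hK : IsCompact K) {k : ℕ}
    (h : IsModerate w) (h' : ∀ i ≤ k, ∀ q : ℕ, SupO w' K i (q : ℤ)) (q : ℕ) :
    SupO (fun ε x => B (w ε x) (w' ε x)) K k (q : ℤ) := by
  obtain ⟨p, hp⟩ := h.unif hK k
  exact (SupO.bilinear B sw sw' hp (fun i hi => h' i hi (p + q))).mono (by push_cast; omega)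

theorem IsModerate.fderiv {w : Par → E → F} (h : IsModerate w) :
    IsModerate (fun ε => fderiv ℝ (w ε)) := by
  intro K hK k
  obtain ⟨p, hp⟩ := h K hK (k + 1)
  exact ⟨p, hp.congr_norm fun _ _ => norm_iteratedFDeriv_fderiv⟩

theorem IsNull.fderiv {w : Par → E → F} (h : IsNull w) :
    IsNull (fun ε => fderiv ℝ (w ε)) :=
  fun K hK k q => (h K hK (k + 1) q).congr_norm fun _ _ => norm_iteratedFDeriv_fderiv

theorem SupO.clm_apply {w : Par → E → (F →L[ℝ] G)} (sw : ∀ ε, ContDiff ℝ ∞ (w ε)) (v : F)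
    {K : Set E} {k : ℕ} {n : ℤ} (h : SupO w K k n) : SupO (fun ε x => w ε x v) K k n := by
  obtain ⟨C, hC⟩ := h
  refine ⟨‖v‖ * C, hC.mono fun ε hε x hx => ?_⟩
  have hk : (k : ℕ∞ω) ≤ ∞ := by exact_mod_cast le_top
  refine (norm_iteratedFDeriv_clm_apply_const (sw ε).contDiffAt hk).trans ?_
  rw [mul_assoc]
  gcongr
  exact hε x hx

theorem SupO.pullback {w : Par → E → F} (sw : ∀ ε, ContDiff ℝ ∞ (w ε)) (L : G →L[ℝ] E)
    {K : Set G} {k : ℕ} {n : ℤ} (h : SupO w (L '' K) k n) :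
    SupO (fun ε x => w ε (L x)) K k n := by
  obtain ⟨C, hC⟩ := h
  refine ⟨C * ‖L‖ ^ k, hC.mono fun ε hε x hx => ?_⟩
  have hk : (k : ℕ∞ω) ≤ ∞ := by exact_mod_cast le_top
  have e : iteratedFDeriv ℝ k (fun x => w ε (L x)) x
      = (iteratedFDeriv ℝ k (w ε) (L x)).compContinuousLinearMap fun _ => L :=
    L.iteratedFDeriv_comp_right (sw ε) x hk
  rw [e]
  refine (ContinuousMultilinearMap.norm_compContinuousLinearMap_le _ _).trans ?_
  rw [Finset.prod_const, Finset.card_univ, Fintype.card_fin]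
  calc ‖iteratedFDeriv ℝ k (w ε) (L x)‖ * ‖L‖ ^ k ≤ (C * (ε : ℝ) ^ n) * ‖L‖ ^ k := by
        gcongr
        exact hε (L x) (Set.mem_image_of_mem _ hx)
    _ = C * ‖L‖ ^ k * (ε : ℝ) ^ n := by ring

theorem PolyGrowth.fderiv {g : F → G} (hg : PolyGrowth g) : PolyGrowth (fderiv ℝ g) where
  smooth := hg.smooth.fderiv_right (by norm_num)
  growth k := by
    obtain ⟨C, p, h⟩ := hg.growth (k + 1)
    exact ⟨C, p, fun y => norm_iteratedFDeriv_fderiv.le.trans (h y)⟩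

theorem PolyGrowth.unif {g : F → G} (hg : PolyGrowth g) (k : ℕ) :
    ∃ (C : ℝ) (p : ℕ), 0 ≤ C ∧ ∀ i ≤ k, ∀ y : F,
      ‖iteratedFDeriv ℝ i g y‖ ≤ C * (1 + ‖y‖) ^ p := by
  induction k with
  | zero =>
    obtain ⟨C, p, h⟩ := hg.growth 0
    refine ⟨|C|, p, abs_nonneg C, fun i hi y => ?_⟩
    obtain rfl : i = 0 := by omega
    refine (h y).trans ?_
    gcongr
    exact le_abs_self C
  | succ k ih =>
    obtain ⟨C, p, hC0, hC⟩ := ih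
    obtain ⟨C', q, hC'⟩ := hg.growth (k + 1)
    refine ⟨max C C', p + q, le_max_of_le_left hC0, fun i hi y => ?_⟩
    have h1 : 1 ≤ 1 + ‖y‖ := by linarith [norm_nonneg y]
    rcases Nat.lt_or_ge k i with hki | hki
    · obtain rfl : i = k + 1 := by omega
      refine (hC' y).trans ?_
      gcongr
      · exact le_max_right _ _
      · omega
    · refine (hC i hki y).trans ?_
      gcongr
      · exact le_max_left _ _
      · omega

theorem IsModerate.comp {g : F → G} (hg : PolyGrowth g) {w : Par → E → F}
    (sw : ∀ ε, ContDiff ℝ ∞ (w ε)) (h : IsModerate w) : IsModerate (fun ε x => g (w ε x)) := by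
  intro K hK k
  obtain ⟨p, hp⟩ := h.unif hK k
  obtain ⟨A, hA0, hA⟩ := SupO.unif hp
  obtain ⟨C, P, hC0, hC⟩ := hg.unif k
  refine ⟨p * (P + k), (k.factorial : ℝ) * C * (1 + A) ^ (P + k), hA.mono fun ε hε x hx => ?_⟩
  have h0 : (0 : ℝ) < ε := ε.2.1
  have hk : (k : ℕ∞ω) ≤ ∞ := by exact_mod_cast le_top
  set s : ℝ := (ε : ℝ) ^ (-(p : ℤ)) with hs
  have hs1 : 1 ≤ s := by
    rw [hs, zpow_neg, zpow_natCast]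
    exact (one_le_inv₀ (by positivity)).2 (pow_le_one₀ h0.le ε.2.2)
  set D : ℝ := (1 + A) * s with hD
  have hD1 : 1 + A * s ≤ D := by rw [hD]; nlinarith
  have hD2 : 1 ≤ D := by nlinarith
  have hux : 1 + ‖w ε x‖ ≤ D := by
    have := hε 0 (Nat.zero_le _) x hx
    rw [norm_iteratedFDeriv_zero] at this
    linarith
  have key := norm_iteratedFDeriv_comp_le (n := k) hg.smooth (sw ε) hk x (C := C * D ^ P) (D := D)
    (fun i hi => (hC i hi _).trans (by gcongr))
    (fun i hi1 hi => by
      refine (hε i hi x hx).trans ?_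
      calc A * s ≤ D := by linarith
        _ ≤ D ^ i := le_self_pow₀ hD2 (by omega))
  refine key.trans (le_of_eq ?_)
  have hsp : s ^ (P + k) = (ε : ℝ) ^ (-((p * (P + k) : ℕ) : ℤ)) := by
    rw [hs, ← zpow_natCast, ← zpow_mul]
    congr 1
    push_cast
    ring
  rw [← hsp, hD, mul_pow, mul_pow, pow_add, pow_add]
  ring

theorem SupO.comp_sub {g : F → G} (hg : PolyGrowth g) {u v : Par → E → F}
    (hu : IsModerate u) (hv : IsModerate v) (h : IsNull (fun ε x => u ε x - v ε x))
    {K : Set E} (hK : IsCompact K) (q : ℕ) :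
    SupO (fun ε x => g (u ε x) - g (v ε x)) K 0 (q : ℤ) := by
  obtain ⟨p₁, hp₁⟩ := hu K hK 0
  obtain ⟨p₂, hp₂⟩ := hv K hK 0
  obtain ⟨A₁, hA₁⟩ := hp₁.mono (m := -((p₁ + p₂ : ℕ) : ℤ)) (by push_cast; omega)
  obtain ⟨A₂, hA₂⟩ := hp₂.mono (m := -((p₁ + p₂ : ℕ) : ℤ)) (by push_cast; omega)
  set p := p₁ + p₂
  obtain ⟨C, P, hC0, hC⟩ := hg.unif 1
  obtain ⟨B, hB⟩ := h K hK 0 (p * P + q)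
  set A := |A₁| + |A₂| with hA
  have hA0 : 0 ≤ A := by positivity
  refine ⟨C * (1 + A) ^ P * B, ((hA₁.and hA₂).and hB).mono ?_⟩
  rintro ε ⟨⟨hε₁, hε₂⟩, hεB⟩ x hx
  have h0 : (0 : ℝ) < ε := ε.2.1
  set s : ℝ := (ε : ℝ) ^ (-(p : ℤ)) with hs
  have hs1 : 1 ≤ s := by
    rw [hs, zpow_neg, zpow_natCast]
    exact (one_le_inv₀ (by positivity)).2 (pow_le_one₀ h0.le ε.2.2)
  have hux := hε₁ x hx
  have hvx := hε₂ x hx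
  have hwx := hεB x hx
  rw [norm_iteratedFDeriv_zero] at hux hvx hwx ⊢
  have hu' : ‖u ε x‖ ≤ A * s := hux.trans (by
    gcongr; linarith [le_abs_self A₁, abs_nonneg A₂])
  have hv' : ‖v ε x‖ ≤ A * s := hvx.trans (by
    gcongr; linarith [le_abs_self A₂, abs_nonneg A₁])
  have mv := (convex_closedBall (0 : F) (A * s)).norm_image_sub_le_of_norm_fderiv_le
    (𝕜 := ℝ) (f := g) (C := C * ((1 + A) * s) ^ P) (x := v ε x) (y := u ε x)
    (fun y _ => (hg.smooth.differentiable (by simp)).differentiableAt)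
    (fun y hy => by
      have hy' : ‖y‖ ≤ A * s := by simpa using hy
      have h1 := hC 1 le_rfl y
      rw [← norm_iteratedFDeriv_fderiv, norm_iteratedFDeriv_zero] at h1
      refine h1.trans ?_
      gcongr
      nlinarith)
    (by simpa using hv') (by simpa using hu')
  refine mv.trans ?_
  have hsp : s ^ P * (ε : ℝ) ^ ((p * P + q : ℕ) : ℤ) = (ε : ℝ) ^ (q : ℤ) := by
    rw [hs, ← zpow_natCast, ← zpow_mul, ← zpow_add₀ h0.ne']
    congr 1
    push_cast
    ring
  calc C * ((1 + A) * s) ^ P * ‖u ε x - v ε x‖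
      ≤ C * ((1 + A) * s) ^ P * (B * (ε : ℝ) ^ ((p * P + q : ℕ) : ℤ)) := by gcongr
    _ = C * (1 + A) ^ P * B * (s ^ P * (ε : ℝ) ^ ((p * P + q : ℕ) : ℤ)) := by
        rw [mul_pow]; ring
    _ = C * (1 + A) ^ P * B * (ε : ℝ) ^ (q : ℤ) := by rw [hsp]

end Estimates

section Superposition

universe v

variable {E : Type*} [NormedAddCommGroup E] [NormedSpace ℝ E]
variable {F : Type v} [NormedAddCommGroup F] [NormedSpace ℝ F]

theorem SupO.comp_sub_all {u v : Par → E → F}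
    (su : ∀ ε, ContDiff ℝ ∞ (u ε)) (sv : ∀ ε, ContDiff ℝ ∞ (v ε))
    (hu : IsModerate u) (hv : IsModerate v) (h : IsNull (fun ε x => u ε x - v ε x))
    {K : Set E} (hK : IsCompact K) (k : ℕ) :
    ∀ (G : Type v) [NormedAddCommGroup G] [NormedSpace ℝ G] (g : F → G), PolyGrowth g →
      ∀ q : ℕ, SupO (fun ε x => g (u ε x) - g (v ε x)) K k (q : ℤ) := by
  induction k using Nat.strong_induction_on with
  | _ k ih =>
    intro G _ _ g hg q
    rcases k with _ | k
    · exact SupO.comp_sub hg hu hv h hK q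
    · have hgd := hg.fderiv
      have d1 : ∀ ε, ContDiff ℝ ∞ (fderiv ℝ (u ε)) := fun ε =>
        (su ε).fderiv_right (by norm_num)
      have d2 : ∀ ε, ContDiff ℝ ∞ (fderiv ℝ (v ε)) := fun ε =>
        (sv ε).fderiv_right (by norm_num)
      have c1 : ∀ ε, ContDiff ℝ ∞ (fun x => fderiv ℝ g (u ε x)) := fun ε =>
        hgd.smooth.comp (su ε)
      have c2 : ∀ ε, ContDiff ℝ ∞ (fun x => fderiv ℝ g (v ε x)) := fun ε =>
        hgd.smooth.comp (sv ε)
      have t1 : SupO (fun ε x => (ContinuousLinearMap.compL ℝ E F G).flip (fderiv ℝ (u ε) x)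
          (fderiv ℝ g (u ε x) - fderiv ℝ g (v ε x))) K k (q : ℤ) :=
        SupO.bilinear_null _ d1 (fun ε => (c1 ε).sub (c2 ε)) hK hu.fderiv
          (fun i hi q => ih i (by omega) (F →L[ℝ] G) (fderiv ℝ g) hgd q) q
      have n2 : IsNull (fun ε x => fderiv ℝ (u ε) x - fderiv ℝ (v ε) x) := by
        have e : (fun ε : Par => fun x => fderiv ℝ (u ε) x - fderiv ℝ (v ε) x)
            = fun ε : Par => fderiv ℝ (fun x => u ε x - v ε x) := by
          funext ε x
          exact (fderiv_fun_sub ((su ε).differentiable (by simp) x)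
            ((sv ε).differentiable (by simp) x)).symm
        rw [e]
        exact h.fderiv
      have t2 : SupO (fun ε x => ContinuousLinearMap.compL ℝ E F G (fderiv ℝ g (v ε x))
          (fderiv ℝ (u ε) x - fderiv ℝ (v ε) x)) K k (q : ℤ) :=
        SupO.bilinear_null _ c2 (fun ε => (d1 ε).sub (d2 ε)) hK (IsModerate.comp hgd sv hv)
          (fun i _ q => n2 K hK i q) q
      have t := SupO.add
        (fun ε => (ContinuousLinearMap.compL ℝ E F G).flip.isBoundedBilinearMap.contDiff.comp
          ((d1 ε).prodMk ((c1 ε).sub (c2 ε))))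
        (fun ε => (ContinuousLinearMap.compL ℝ E F G).isBoundedBilinearMap.contDiff.comp
          ((c2 ε).prodMk ((d1 ε).sub (d2 ε)))) t1 t2
      refine t.congr_norm fun ε x => ?_
      rw [← norm_iteratedFDeriv_fderiv]
      congr 2
      funext y
      have dg : Differentiable ℝ g := hg.smooth.differentiable (by simp)
      have du : Differentiable ℝ (u ε) := (su ε).differentiable (by simp)
      have dv : Differentiable ℝ (v ε) := (sv ε).differentiable (by simp)
      have e1 : fderiv ℝ (fun x => g (u ε x)) y = (fderiv ℝ g (u ε y)).comp (fderiv ℝ (u ε) y) :=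
        fderiv_comp y (dg _) (du y)
      have e2 : fderiv ℝ (fun x => g (v ε x)) y = (fderiv ℝ g (v ε y)).comp (fderiv ℝ (v ε) y) :=
        fderiv_comp y (dg _) (dv y)
      have e3 := fderiv_fun_sub (𝕜 := ℝ) (f := fun x => g (u ε x)) (g := fun x => g (v ε x)) (x := y)
        ((dg.comp du) y) ((dg.comp dv) y)
      rw [e3, e1, e2]
      ext z
      simp

end Superposition

section Algebra

variable (E : Type*) [NormedAddCommGroup E] [NormedSpace ℝ E]
variable (𝕜 : Type*) [RCLike 𝕜]

/-- The algebra of moderate families of smooth functions `E → 𝕜`, with pointwise operations. -/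
def Moderate : Subalgebra 𝕜 (Par → E → 𝕜) where
  carrier := {u | (∀ ε, ContDiff ℝ ∞ (u ε)) ∧ IsModerate u}
  mul_mem' := fun hu hv =>
    ⟨fun ε => (hu.1 ε).mul (hv.1 ε),
      IsModerate.bilinear (ContinuousLinearMap.mul ℝ 𝕜) hu.1 hv.1 hu.2 hv.2⟩
  add_mem' := fun hu hv =>
    ⟨fun ε => (hu.1 ε).add (hv.1 ε), IsModerate.add hu.1 hv.1 hu.2 hv.2⟩
  algebraMap_mem' := fun c => ⟨fun _ => contDiff_const, IsModerate.const c⟩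

/-- The ideal of null families. -/
def Null : Ideal (Moderate E 𝕜) where
  carrier := {u | IsNull (u : Par → E → 𝕜)}
  add_mem' := fun {u v} hu hv => IsNull.add u.2.1 v.2.1 hu hv
  zero_mem' := IsNull.zero
  smul_mem' := fun c u hu K hK _ q =>
    SupO.bilinear_null (ContinuousLinearMap.mul ℝ 𝕜) c.2.1 u.2.1 hK c.2.2
      (fun i _ q => hu K hK i q) q

/-- The (special) Colombeau algebra `𝒢(E)` of `𝕜`-valued generalized functions on the whole of a
finite-dimensional space `E`: moderate families modulo null families. -/
def GenFun : Type _ := Moderate E 𝕜 ⧸ Null E 𝕜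

noncomputable instance : CommRing (GenFun E 𝕜) :=
  inferInstanceAs (CommRing (Moderate E 𝕜 ⧸ Null E 𝕜))

noncomputable instance : Algebra 𝕜 (GenFun E 𝕜) :=
  inferInstanceAs (Algebra 𝕜 (Moderate E 𝕜 ⧸ Null E 𝕜))

variable {E 𝕜}

/-- The class of a moderate family. -/
def GenFun.mk (u : Moderate E 𝕜) : GenFun E 𝕜 := Ideal.Quotient.mk (Null E 𝕜) u

theorem GenFun.mk_surjective : Function.Surjective (GenFun.mk : Moderate E 𝕜 → GenFun E 𝕜) :=
  Ideal.Quotient.mk_surjective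

theorem GenFun.mk_add (u v : Moderate E 𝕜) : GenFun.mk (u + v) = GenFun.mk u + GenFun.mk v := rfl

theorem GenFun.mk_neg (u : Moderate E 𝕜) : GenFun.mk (-u) = -GenFun.mk u := rfl

theorem GenFun.mk_zero : GenFun.mk (0 : Moderate E 𝕜) = 0 := rfl

theorem GenFun.mk_eq_mk {u v : Moderate E 𝕜} :
    GenFun.mk u = GenFun.mk v ↔
      IsNull (fun ε x => (u : Par → E → 𝕜) ε x - (v : Par → E → 𝕜) ε x) :=
  Ideal.Quotient.eq

/-- An operation on moderate families that respects null differences acts on classes. -/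
def GenFun.map {E' : Type*} [NormedAddCommGroup E'] [NormedSpace ℝ E']
    (Φ : Moderate E 𝕜 → Moderate E' 𝕜)
    (hΦ : ∀ u v, GenFun.mk u = GenFun.mk v → GenFun.mk (Φ u) = GenFun.mk (Φ v)) :
    GenFun E 𝕜 → GenFun E' 𝕜 :=
  Quotient.lift (fun u => GenFun.mk (Φ u))
    (fun u v huv => hΦ u v (Quotient.sound huv))

theorem GenFun.map_mk {E' : Type*} [NormedAddCommGroup E'] [NormedSpace ℝ E']
    (Φ : Moderate E 𝕜 → Moderate E' 𝕜)
    (hΦ : ∀ u v, GenFun.mk u = GenFun.mk v → GenFun.mk (Φ u) = GenFun.mk (Φ v))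
    (u : Moderate E 𝕜) : GenFun.map Φ hΦ (GenFun.mk u) = GenFun.mk (Φ u) := rfl

/-- The directional derivative of a moderate family: `(∂_v u) ε x = D(u ε)(x) v`. -/
noncomputable def Moderate.dir (v : E) (u : Moderate E 𝕜) : Moderate E 𝕜 :=
  ⟨fun ε x => fderiv ℝ ((u : Par → E → 𝕜) ε) x v,
    fun ε => ((u.2.1 ε).fderiv_right (by norm_num)).clm_apply contDiff_const,
    fun K hK k => by
      obtain ⟨p, hp⟩ := u.2.2.fderiv K hK k
      exact ⟨p, hp.clm_apply (fun ε => (u.2.1 ε).fderiv_right (by norm_num)) v⟩⟩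

/-- The directional derivative `∂_v` on the Colombeau algebra. -/
noncomputable def GenFun.dir (v : E) : GenFun E 𝕜 → GenFun E 𝕜 :=
  GenFun.map (Moderate.dir v) fun u w huw => by
    rw [GenFun.mk_eq_mk] at huw ⊢
    have e : (fun (ε : Par) x => (Moderate.dir v u : Par → E → 𝕜) ε x
          - (Moderate.dir v w : Par → E → 𝕜) ε x)
        = fun (ε : Par) x => fderiv ℝ
          (fun x => (u : Par → E → 𝕜) ε x - (w : Par → E → 𝕜) ε x) x v := by
      funext ε x
      rw [fderiv_fun_sub ((u.2.1 ε).differentiable (by simp) x)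
            ((w.2.1 ε).differentiable (by simp) x)]
      rfl
    rw [e]
    exact fun K hK k q => (huw.fderiv K hK k q).clm_apply
      (fun ε => ((u.2.1 ε).sub (w.2.1 ε)).fderiv_right (by norm_num)) v

/-- The pullback of a moderate family along a continuous linear map `L`. -/
def Moderate.pullback {E' : Type*} [NormedAddCommGroup E'] [NormedSpace ℝ E'] (L : E' →L[ℝ] E)
    (u : Moderate E 𝕜) : Moderate E' 𝕜 :=
  ⟨fun ε x => (u : Par → E → 𝕜) ε (L x),
    fun ε => (u.2.1 ε).comp L.contDiff,
    fun K hK k => by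
      obtain ⟨p, hp⟩ := u.2.2 (L '' K) (hK.image L.continuous) k
      exact ⟨p, hp.pullback u.2.1 L⟩⟩

/-- The pullback of generalized functions along a continuous linear map. -/
def GenFun.pullback {E' : Type*} [NormedAddCommGroup E'] [NormedSpace ℝ E'] (L : E' →L[ℝ] E) :
    GenFun E 𝕜 → GenFun E' 𝕜 :=
  GenFun.map (Moderate.pullback L) fun u w huw => by
    rw [GenFun.mk_eq_mk] at huw ⊢
    exact fun K hK k q => (huw (L '' K) (hK.image L.continuous) k q).pullback
      (fun ε => (u.2.1 ε).sub (w.2.1 ε)) L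

/-- The superposition `f(u)` of a moderate family. -/
def Moderate.superpose (f : 𝕜 → 𝕜) (hf : PolyGrowth f) (u : Moderate E 𝕜) : Moderate E 𝕜 :=
  ⟨fun ε x => f ((u : Par → E → 𝕜) ε x),
    fun ε => hf.smooth.comp (u.2.1 ε), IsModerate.comp hf u.2.1 u.2.2⟩

/-- The superposition `f(u)` of a generalized function `u` and a smooth function `f` that is of at
most polynomial growth together with all its derivatives. -/
def GenFun.superpose (f : 𝕜 → 𝕜) (hf : PolyGrowth f) : GenFun E 𝕜 → GenFun E 𝕜 :=
  GenFun.map (Moderate.superpose f hf) fun u w huw => by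
    rw [GenFun.mk_eq_mk] at huw ⊢
    exact fun K hK k q =>
      SupO.comp_sub_all u.2.1 w.2.1 u.2.2 w.2.2 huw hK k 𝕜 f hf q

/-- The sets `V(K,m,p)`: the generalized functions with a representative whose derivatives of
order at most `m` are `O(ε ^ p)`, uniformly on `K`. -/
def sharpNhd (K : Set E) (m p : ℕ) : Set (GenFun E 𝕜) :=
  {u | ∃ r : Moderate E 𝕜, GenFun.mk r = u ∧
    ∀ k ≤ m, SupO (r : Par → E → 𝕜) K k (p : ℤ)}

variable (E 𝕜) in
/-- The sets `V(K,m,p)`, with `K` compact, as a base of neighbourhoods of zero. -/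
@[reducible]
noncomputable def sharpBasis : AddGroupFilterBasis (GenFun E 𝕜) :=
  addGroupFilterBasisOfComm
    {V | ∃ (K : Set E) (m p : ℕ), IsCompact K ∧ V = sharpNhd K m p}
    ⟨_, ∅, 0, 0, isCompact_empty, rfl⟩
    (by
      rintro _ _ ⟨K, m, p, hK, rfl⟩ ⟨K', m', p', hK', rfl⟩
      refine ⟨_, ⟨K ∪ K', m + m', p + p', hK.union hK', rfl⟩, ?_⟩
      rintro _ ⟨r, rfl, hr⟩
      refine ⟨⟨r, rfl, fun k hk => ?_⟩, ⟨r, rfl, fun k hk => ?_⟩⟩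
      · obtain ⟨C, hC⟩ := (hr k (by omega)).mono (m := (p : ℤ)) (by push_cast; omega)
        exact ⟨C, hC.mono fun ε hε x hx => hε x (Or.inl hx)⟩
      · obtain ⟨C, hC⟩ := (hr k (by omega)).mono (m := (p' : ℤ)) (by push_cast; omega)
        exact ⟨C, hC.mono fun ε hε x hx => hε x (Or.inr hx)⟩)
    (by
      rintro _ ⟨K, m, p, hK, rfl⟩
      exact ⟨0, GenFun.mk_zero, fun k _ => IsNull.zero K hK k p⟩)
    (by
      rintro _ ⟨K, m, p, hK, rfl⟩
      refine ⟨_, ⟨K, m, p, hK, rfl⟩, ?_⟩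
      rintro _ ⟨_, ⟨r, rfl, hr⟩, _, ⟨s, rfl, hs⟩, rfl⟩
      exact ⟨r + s, GenFun.mk_add r s, fun k hk => SupO.add r.2.1 s.2.1 (hr k hk) (hs k hk)⟩)
    (by
      rintro _ ⟨K, m, p, hK, rfl⟩
      refine ⟨_, ⟨K, m, p, hK, rfl⟩, ?_⟩
      rintro _ ⟨r, rfl, hr⟩
      exact ⟨-r, GenFun.mk_neg r, fun k hk => (hr k hk).neg⟩)

/-- The sharp topology: the translation invariant topology with the sets `V(K,m,p)` as a base of
neighbourhoods of zero. -/
noncomputable instance : TopologicalSpace (GenFun E 𝕜) := (sharpBasis E 𝕜).topology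

end Algebra

section Wave

variable {𝕜 : Type*} [RCLike 𝕜]

/-- `∂_x` on `𝒢(ℝ²)`; points of `ℝ²` are pairs `(x, t)`. -/
noncomputable def dx : GenFun (ℝ × ℝ) 𝕜 → GenFun (ℝ × ℝ) 𝕜 := GenFun.dir ((1, 0) : ℝ × ℝ)

/-- `∂_t` on `𝒢(ℝ²)`. -/
noncomputable def dt : GenFun (ℝ × ℝ) 𝕜 → GenFun (ℝ × ℝ) 𝕜 := GenFun.dir ((0, 1) : ℝ × ℝ)

/-- The restriction of `u ∈ 𝒢(ℝ²)` to the line `t = 0`: the class of `x ↦ u ε (x, 0)`. -/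
noncomputable def initial : GenFun (ℝ × ℝ) 𝕜 → GenFun ℝ 𝕜 :=
  GenFun.pullback (ContinuousLinearMap.inl ℝ ℝ ℝ)

/-- `u ∈ 𝒢(ℝ²)` solves `u_tt - u_xx = f(u) + h`, `u(·,0) = a`, `u_t(·,0) = b`. -/
structure IsWaveSolution (f : 𝕜 → 𝕜) (hf : PolyGrowth f) (a b : GenFun ℝ 𝕜)
    (h u : GenFun (ℝ × ℝ) 𝕜) : Prop where
  equation : dt (dt u) - dx (dx u) = GenFun.superpose f hf u + h
  position : initial u = a
  velocity : initial (dt u) = b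

end Wave

end Colombeau

/-! The wave operator factors into two derivatives along the null directions `(1,1)` and `(-1,1)`,
so every statement about it reduces to integration along characteristics (`transport`).
Characteristics issuing from a point of the diamond `|x| + |t| ≤ T` stay in it down to the line `t =
0`, so all estimates close on one diamond, for both signs of time, and every compact set lies in a
diamond.

Existence for fixed `ε`: Picard iteration contracts in a norm weighted by an exponential in `|t|`,
because `f` is globally Lipschitz (`picard_step`). The null derivatives of the limit are expressed
through its values alone, which gives smoothness by bootstrapping (`exists_smooth_solution`).

Dependence on `ε`: the Gronwall estimate `norm_le_of_norm_box_le` has a constant depending only on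
`T` and the Lipschitz constant, so at order zero no power of `ε` is lost. Higher orders need no
further Gronwall argument: `k + 1` derivatives of a function are controlled by its initial data and
by `k` derivatives of its image under the wave operator (`SupO.succ_of_box`), and for a solution
that image is `f(u) + h`, which contains only `k` derivatives of `u`. Each such step loses finitely
many powers of `ε`, by the polynomial growth of `f`. Hence smooth solutions with moderate data form
a moderate family (`isModerate_of_box`).

The same induction applied to a difference gives `SupO.stability`. There the required accuracy `q`
of the data is fixed by one solution `u`, the domain and the desired accuracy, before the other
family is named. Uniqueness is the case of data that differ by null families; continuity at a point
is the estimate itself. -/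

namespace Colombeau

/-! ### Smoothness and derivative bounds for integrals over [0,1] with a parameter. -/

section ParametricIntegral

open MeasureTheory

universe v

theorem hasFDerivAt_integral_zero_one {E : Type*} [NormedAddCommGroup E] [NormedSpace ℝ E]
    [ProperSpace E] {F : Type*} [NormedAddCommGroup F] [NormedSpace ℝ F]
    {G : E × ℝ → F} (hG : ContDiff ℝ 1 G) (z : E) :
    HasFDerivAt (fun z => ∫ r in (0 : ℝ)..1, G (z, r))
      (∫ r in (0 : ℝ)..1, (fderiv ℝ G (z, r)).comp (ContinuousLinearMap.inl ℝ E ℝ)) z := by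
  have hc : Continuous fun y : E × ℝ => (fderiv ℝ G y).comp (ContinuousLinearMap.inl ℝ E ℝ) :=
    (hG.continuous_fderiv (by norm_num)).clm_comp continuous_const
  obtain ⟨C, hC⟩ := ((isCompact_closedBall z 1).prod
    (isCompact_Icc (a := (0 : ℝ)) (b := 1))).exists_bound_of_continuousOn hc.continuousOn
  refine intervalIntegral.hasFDerivAt_integral_of_dominated_of_fderiv_le
    (F := fun z r => G (z, r)) (s := Metric.ball z 1) (bound := fun _ => C)
    (F' := fun z r => (fderiv ℝ G (z, r)).comp (ContinuousLinearMap.inl ℝ E ℝ))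
    (Metric.ball_mem_nhds z one_pos) ?_ ?_ ?_ ?_ ?_ ?_
  · exact Eventually.of_forall fun y =>
      (hG.continuous.comp (by fun_prop : Continuous fun r : ℝ => (y, r))).aestronglyMeasurable
  · exact (hG.continuous.comp (by fun_prop : Continuous fun r : ℝ => (z, r))).intervalIntegrable _ _
  · exact (hc.comp (by fun_prop : Continuous fun r : ℝ => (z, r))).aestronglyMeasurable
  · refine Eventually.of_forall fun r hr y hy => hC (y, r) ⟨Metric.ball_subset_closedBall hy, ?_⟩
    rw [Set.uIoc_of_le zero_le_one] at hr
    exact Set.Ioc_subset_Icc_self hr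
  · exact intervalIntegrable_const
  · refine Eventually.of_forall fun r _ y _ => ?_
    exact ((hG.differentiable (by norm_num)) (y, r)).hasFDerivAt.comp y (hasFDerivAt_prodMk_left y r)

variable {E : Type} [NormedAddCommGroup E] [NormedSpace ℝ E] [ProperSpace E]

/-- Differentiating under the integral replaces `F` by `E →L[ℝ] F`, so the induction runs over all
target spaces; `E : Type` keeps these in one universe. -/
theorem contDiff_integral_zero_one (n : ℕ) :
    ∀ {F : Type v} [NormedAddCommGroup F] [NormedSpace ℝ F] {G : E × ℝ → F},
      ContDiff ℝ n G → ContDiff ℝ n (fun z => ∫ r in (0 : ℝ)..1, G (z, r)) := by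
  induction n with
  | zero =>
    intro F _ _ G hG
    have h := hG.continuous
    exact contDiff_zero.2 (intervalIntegral.continuous_parametric_intervalIntegral_of_continuous'
      (f := fun z r => G (z, r)) h 0 1)
  | succ n ih =>
    intro F _ _ G hG
    have h1 := hasFDerivAt_integral_zero_one (hG.of_le (by norm_num))
    refine (contDiff_succ_iff_fderiv (n := (n : ℕ∞ω))).2
      ⟨fun z => (h1 z).differentiableAt, fun h => by simp at h, ?_⟩
    rw [funext fun z => (h1 z).fderiv]
    exact ih (G := fun y => (fderiv ℝ G y).comp (ContinuousLinearMap.inl ℝ E ℝ))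
      ((hG.fderiv_right (by norm_num)).clm_comp contDiff_const)

theorem norm_iteratedFDeriv_integral_zero_one_le (k : ℕ) :
    ∀ {F : Type v} [NormedAddCommGroup F] [NormedSpace ℝ F] {G : E × ℝ → F} {z : E} {C : ℝ},
      ContDiff ℝ ∞ G →
      (∀ r ∈ Set.Icc (0 : ℝ) 1, ‖iteratedFDeriv ℝ k (fun y => G (y, r)) z‖ ≤ C) →
      ‖iteratedFDeriv ℝ k (fun z => ∫ r in (0 : ℝ)..1, G (z, r)) z‖ ≤ C := by
  induction k with
  | zero =>
    intro F _ _ G z C hG h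
    simp only [norm_iteratedFDeriv_zero] at h ⊢
    refine (intervalIntegral.norm_integral_le_of_norm_le_const (C := C) fun r hr => h r ?_).trans
      (by simp)
    rw [Set.uIoc_of_le zero_le_one] at hr
    exact Set.Ioc_subset_Icc_self hr
  | succ n ih =>
    intro F _ _ G z C hG h
    have h1 := hasFDerivAt_integral_zero_one (hG.of_le (by simp))
    rw [← norm_iteratedFDeriv_fderiv, funext fun z => (h1 z).fderiv]
    refine ih (G := fun y => (fderiv ℝ G y).comp (ContinuousLinearMap.inl ℝ E ℝ))
      ((hG.fderiv_right (by norm_num)).clm_comp contDiff_const) fun r hr => ?_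
    refine le_trans (le_of_eq ?_) (h r hr)
    rw [← norm_iteratedFDeriv_fderiv]
    congr 2
    funext y
    exact (((hG.differentiable (by simp)) (y, r)).hasFDerivAt.comp y
      (hasFDerivAt_prodMk_left y r)).fderiv.symm

end ParametricIntegral

/-! ### Integration along characteristics. -/

section Transport

variable {F : Type*} [NormedAddCommGroup F] [NormedSpace ℝ F]

/-- The solution `w` of `∂_t w - c ∂_x w = g` with `w(·,0) = 0`. -/
noncomputable def transport (c : ℝ) (g : ℝ × ℝ → F) (z : ℝ × ℝ) : F :=
  ∫ s in (0 : ℝ)..z.2, g (z.1 + c * (z.2 - s), s)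

/-- The linear map that sends `z` to the point at the fraction `r` of the characteristic of speed
`c` from the line `t = 0` to `z`. -/
noncomputable def charMap (c r : ℝ) : ℝ × ℝ →L[ℝ] ℝ × ℝ :=
  (ContinuousLinearMap.fst ℝ ℝ ℝ + (c * (1 - r)) • ContinuousLinearMap.snd ℝ ℝ ℝ).prod
    (r • ContinuousLinearMap.snd ℝ ℝ ℝ)

@[simp] theorem charMap_apply (c r : ℝ) (z : ℝ × ℝ) :
    charMap c r z = (z.1 + c * (1 - r) * z.2, r * z.2) := by
  simp [charMap]

/-- The substitution `s = r * z.2` makes the limits constant and the dependence on `z` linear inside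
`g`, so that regularity and derivative bounds follow from those of a parametric integral. -/
theorem transport_eq_smul (c : ℝ) (g : ℝ × ℝ → F) (z : ℝ × ℝ) :
    transport c g z = z.2 • ∫ r in (0 : ℝ)..1, g (charMap c r z) := by
  have := intervalIntegral.smul_integral_comp_mul_right (a := (0 : ℝ)) (b := 1)
    (fun s => g (z.1 + c * (z.2 - s), s)) z.2
  simp only [zero_mul, one_mul] at this
  rw [transport, ← this]
  congr 2
  funext r
  rw [charMap_apply]
  congr 2
  ring

theorem contDiff_comp_charMap (c : ℝ) {g : ℝ × ℝ → F} {n : ℕ∞ω} (hg : ContDiff ℝ n g) :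
    ContDiff ℝ n (fun y : (ℝ × ℝ) × ℝ => g (charMap c y.2 y.1)) := by
  refine hg.comp ?_
  simp only [charMap_apply]
  fun_prop

theorem contDiff_transport (c : ℝ) {g : ℝ × ℝ → F} {n : ℕ} (hg : ContDiff ℝ n g) :
    ContDiff ℝ n (transport c g) := by
  rw [funext (transport_eq_smul c g)]
  exact contDiff_snd.smul (contDiff_integral_zero_one n (contDiff_comp_charMap c hg))

theorem contDiff_transport_infty (c : ℝ) {g : ℝ × ℝ → F} (hg : ContDiff ℝ ∞ g) :
    ContDiff ℝ ∞ (transport c g) :=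
  contDiff_infty.2 fun n => contDiff_transport c (hg.of_le (by exact_mod_cast le_top))

theorem continuous_transport (c : ℝ) {g : ℝ × ℝ → F} (hg : Continuous g) :
    Continuous (transport c g) :=
  contDiff_zero.1 (contDiff_transport (n := 0) c (contDiff_zero.2 hg))

theorem transport_initial (c : ℝ) (g : ℝ × ℝ → F) (x : ℝ) : transport c g (x, 0) = 0 := by
  simp [transport]

theorem continuous_char {X : Type*} [TopologicalSpace X] {g : ℝ × ℝ → X} (hg : Continuous g)
    (c : ℝ) (z : ℝ × ℝ) : Continuous fun s => g (z.1 + c * (z.2 - s), s) := by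
  fun_prop

theorem transport_sub (c : ℝ) {g h : ℝ × ℝ → F} (hg : Continuous g) (hh : Continuous h)
    (z : ℝ × ℝ) : transport c (fun y => g y - h y) z = transport c g z - transport c h z :=
  intervalIntegral.integral_sub ((continuous_char hg c z).intervalIntegrable _ _)
    ((continuous_char hh c z).intervalIntegrable _ _)

variable [CompleteSpace F]

theorem fderiv_transport (c : ℝ) {g : ℝ × ℝ → F} (hg : ContDiff ℝ 1 g) (z : ℝ × ℝ) :
    fderiv ℝ (transport c g) z (-c, 1) = g z := by
  have hd : DifferentiableAt ℝ (transport c g) z :=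
    (contDiff_transport (n := 1) c (by exact_mod_cast hg)).differentiable (by norm_num) z
  have h1 : HasDerivAt (fun τ : ℝ => transport c g (z + τ • ((-c, 1) : ℝ × ℝ)))
      (fderiv ℝ (transport c g) z (-c, 1)) 0 := hd.hasFDerivAt.hasLineDerivAt _
  -- A shift of `z` by `τ • (-c, 1)` stays on the same characteristic, so only the upper limit of
  -- the integral moves.
  have h2 : HasDerivAt (fun τ : ℝ => ∫ s in (0 : ℝ)..(z.2 + τ), g (z.1 + c * (z.2 - s), s))
      (g z) 0 := by
    have hcont := continuous_char hg.continuous c z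
    have := (hcont.integral_hasStrictDerivAt 0 z.2).hasDerivAt
    have h3 : HasDerivAt (fun t => ∫ s in (0 : ℝ)..t, g (z.1 + c * (z.2 - s), s)) (g z)
        (z.2 + 0) := by
      simpa using this
    exact h3.comp_const_add z.2 0
  refine h1.unique (h2.congr_of_eventuallyEq (Eventually.of_forall fun τ => ?_))
  simp only [transport, Prod.fst_add, Prod.snd_add, Prod.smul_fst, Prod.smul_snd, smul_eq_mul]
  rw [mul_one]
  refine intervalIntegral.integral_congr fun s _ => congrArg g ?_
  exact Prod.ext (by simp only; ring) rfl

/-- The fundamental theorem of calculus on the characteristic from its foot on `t = 0` to `z`. -/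
theorem eq_add_transport (c : ℝ) {w : ℝ × ℝ → F} (hw : ContDiff ℝ 1 w) (z : ℝ × ℝ) :
    w z = w (z.1 + c * z.2, 0) + transport c (fun y => fderiv ℝ w y (-c, 1)) z := by
  have hd : ∀ s, HasDerivAt (fun s : ℝ => w (z.1 + c * (z.2 - s), s))
      (fderiv ℝ w (z.1 + c * (z.2 - s), s) (-c, 1)) s := by
    intro s
    have h1 : HasDerivAt (fun s : ℝ => ((z.1 + c * (z.2 - s), s) : ℝ × ℝ)) (-c, 1) s := by
      refine HasDerivAt.prodMk ?_ (hasDerivAt_id s)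
      simpa using (((hasDerivAt_id s).const_sub z.2).const_mul c).const_add z.1
    exact ((hw.differentiable (by norm_num)) _).hasFDerivAt.comp_hasDerivAt s h1
  have hc : Continuous fun y => fderiv ℝ w y (-c, 1) :=
    (hw.continuous_fderiv (by norm_num)).clm_apply continuous_const
  have := intervalIntegral.integral_eq_sub_of_hasDerivAt (a := 0) (b := z.2) (fun s _ => hd s)
    ((continuous_char hc c z).intervalIntegrable _ _)
  rw [transport, this]
  simp

end Transport

/-! ### Domains of determinacy and weighted bounds on them. -/

section Diamond

variable {F : Type*} [NormedAddCommGroup F] [NormedSpace ℝ F]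

/-- The closed diamond with the base `[-T, T]` on the line `t = 0`. -/
def diamond (T : ℝ) : Set (ℝ × ℝ) := {z | |z.1| + |z.2| ≤ T}

theorem isCompact_diamond (T : ℝ) : IsCompact (diamond T) := by
  refine (isCompact_closedBall (0 : ℝ × ℝ) T).of_isClosed_subset
    (isClosed_le (by fun_prop) continuous_const) fun z hz => ?_
  have hz' : |z.1| + |z.2| ≤ T := hz
  rw [mem_closedBall_zero_iff, Prod.norm_def, Real.norm_eq_abs, Real.norm_eq_abs, max_le_iff]
  constructor <;> linarith [abs_nonneg z.1, abs_nonneg z.2]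

theorem abs_snd_le_of_mem_diamond {T : ℝ} {z : ℝ × ℝ} (hz : z ∈ diamond T) : |z.2| ≤ T := by
  have hz' : |z.1| + |z.2| ≤ T := hz
  linarith [abs_nonneg z.1]

theorem exists_subset_diamond {K : Set (ℝ × ℝ)} (hK : IsCompact K) :
    ∃ T : ℝ, 0 ≤ T ∧ K ⊆ diamond T := by
  obtain ⟨C, hC⟩ := hK.isBounded.exists_norm_le
  refine ⟨|C| + |C|, by positivity, fun z hz => ?_⟩
  have h := (hC z hz).trans (le_abs_self C)
  rw [Prod.norm_def, max_le_iff] at h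
  exact add_le_add h.1 h.2

theorem abs_sub_add_abs_of_mem_uIcc {s t : ℝ} (hs : s ∈ Set.uIcc 0 t) : |t - s| + |s| = |t| := by
  rcases le_total 0 t with ht | ht
  · rw [Set.uIcc_of_le ht] at hs
    rw [abs_of_nonneg ht, abs_of_nonneg hs.1, abs_of_nonneg (by linarith [hs.2])]
    ring
  · rw [Set.uIcc_of_ge ht] at hs
    rw [abs_of_nonpos ht, abs_of_nonpos hs.2, abs_of_nonpos (by linarith [hs.1])]
    ring

/-- Finite propagation speed: going from height `z.2` to `s` frees `|z.2 - s|` in the time term, and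
the horizontal displacement is at most that much. -/
theorem char_mem_diamond {T c s : ℝ} (hc : |c| ≤ 1) {z : ℝ × ℝ} (hz : z ∈ diamond T)
    (hs : s ∈ Set.uIcc 0 z.2) : (z.1 + c * (z.2 - s), s) ∈ diamond T := by
  have h := abs_sub_add_abs_of_mem_uIcc hs
  have hz' : |z.1| + |z.2| ≤ T := hz
  have h1 : |z.1 + c * (z.2 - s)| ≤ |z.1| + |z.2 - s| := by
    refine (abs_add_le _ _).trans (add_le_add le_rfl ?_)
    rw [abs_mul]
    exact mul_le_of_le_one_left (abs_nonneg _) hc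
  change |z.1 + c * (z.2 - s)| + |s| ≤ T
  linarith

theorem charMap_mem_diamond {T c r : ℝ} (hc : |c| ≤ 1) (hr : r ∈ Set.Icc (0 : ℝ) 1) {z : ℝ × ℝ}
    (hz : z ∈ diamond T) : charMap c r z ∈ diamond T := by
  have e : charMap c r z = (z.1 + c * (z.2 - r * z.2), r * z.2) := by
    rw [charMap_apply]
    congr 1
    ring
  rw [e]
  refine char_mem_diamond hc hz ?_
  rcases le_total 0 z.2 with ht | ht
  · rw [Set.uIcc_of_le ht]
    exact ⟨mul_nonneg hr.1 ht, mul_le_of_le_one_left ht hr.2⟩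
  · rw [Set.uIcc_of_ge ht]
    exact ⟨by nlinarith [hr.2], mul_nonpos_of_nonneg_of_nonpos hr.1 ht⟩

theorem foot_mem_diamond {T c : ℝ} (hc : |c| ≤ 1) {z : ℝ × ℝ} (hz : z ∈ diamond T) :
    (z.1 + c * z.2, (0 : ℝ)) ∈ diamond T := by
  simpa using char_mem_diamond hc hz (s := 0) Set.left_mem_uIcc

theorem norm_transport_le {T c M : ℝ} (hc : |c| ≤ 1) {g : ℝ × ℝ → F}
    (hM : ∀ y ∈ diamond T, ‖g y‖ ≤ M) {z : ℝ × ℝ} (hz : z ∈ diamond T) :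
    ‖transport c g z‖ ≤ T * M := by
  have hM0 : 0 ≤ M := (norm_nonneg _).trans (hM z hz)
  refine (intervalIntegral.norm_integral_le_of_norm_le_const (C := M) fun s hs =>
    hM _ (char_mem_diamond hc hz (Set.uIoc_subset_uIcc hs))).trans ?_
  rw [sub_zero, mul_comm]
  gcongr
  exact abs_snd_le_of_mem_diamond hz

theorem abs_integral_exp_abs_le {l : ℝ} (hl : 0 < l) (t : ℝ) :
    |∫ s in (0 : ℝ)..t, Real.exp (l * |s|)| ≤ Real.exp (l * |t|) / l := by
  have key : ∀ t : ℝ, 0 ≤ t →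
      ∫ s in (0 : ℝ)..t, Real.exp (l * |s|) = (Real.exp (l * t) - 1) / l := by
    intro t ht
    have : ∫ s in (0 : ℝ)..t, Real.exp (l * |s|) = ∫ s in (0 : ℝ)..t, Real.exp (l * s) := by
      refine intervalIntegral.integral_congr fun s hs => ?_
      rw [Set.uIcc_of_le ht] at hs
      simp only [abs_of_nonneg hs.1]
    rw [this, intervalIntegral.integral_comp_mul_left (fun s => Real.exp s) hl.ne']
    simp [div_eq_inv_mul]
  have bound : ∀ t : ℝ, 0 ≤ t →
      |∫ s in (0 : ℝ)..t, Real.exp (l * |s|)| ≤ Real.exp (l * |t|) / l := by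
    intro t ht
    have h1 : 1 ≤ Real.exp (l * t) := Real.one_le_exp (by positivity)
    rw [key t ht, abs_of_nonneg ht, abs_of_nonneg (div_nonneg (by linarith) hl.le)]
    gcongr
    linarith
  rcases le_total 0 t with ht | ht
  · exact bound t ht
  · have h := bound (-t) (by linarith)
    have e : ∫ s in (0 : ℝ)..(-t), Real.exp (l * |s|) = -∫ s in (0 : ℝ)..t, Real.exp (l * |s|) := by
      have := intervalIntegral.integral_comp_neg (a := 0) (b := t) (fun s => Real.exp (l * |s|))
      simp only [abs_neg, neg_zero] at this
      rw [this, intervalIntegral.integral_symm]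
    rwa [e, abs_neg, abs_neg] at h

/-- In the weighted norm each integration gains the factor `1 / l`. Large `l` therefore gives a
contraction on a diamond of any size, with no subdivision of the time interval. -/
theorem norm_transport_le_exp {T c M l : ℝ} (hl : 0 < l) (hc : |c| ≤ 1) {g : ℝ × ℝ → F}
    (hM : ∀ y ∈ diamond T, ‖g y‖ ≤ M * Real.exp (l * |y.2|)) {z : ℝ × ℝ} (hz : z ∈ diamond T) :
    ‖transport c g z‖ ≤ M / l * Real.exp (l * |z.2|) := by
  have hM0 : 0 ≤ M :=
    nonneg_of_mul_nonneg_left ((norm_nonneg _).trans (hM z hz)) (Real.exp_pos _)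
  have h := intervalIntegral.norm_integral_le_abs_of_norm_le (μ := MeasureTheory.volume)
    (f := fun s => g (z.1 + c * (z.2 - s), s)) (g := fun s => M * Real.exp (l * |s|))
    (a := 0) (b := z.2)
    ((MeasureTheory.ae_restrict_mem measurableSet_uIoc).mono fun s hs =>
      hM _ (char_mem_diamond hc hz (Set.uIoc_subset_uIcc hs)))
    ((by fun_prop : Continuous fun s : ℝ => M * Real.exp (l * |s|)).intervalIntegrable _ _)
  refine h.trans ?_
  rw [intervalIntegral.integral_const_mul, abs_mul, abs_of_nonneg hM0, div_mul_eq_mul_div,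
    mul_div_assoc]
  gcongr
  exact abs_integral_exp_abs_le hl z.2

end Diamond

/-! ### The null frame and the factorized wave operator. -/

section NullFrame

variable {F : Type*} [NormedAddCommGroup F] [NormedSpace ℝ F]

/-- The coordinate `(x + t) / 2`. -/
noncomputable def nullCoordX : ℝ × ℝ →L[ℝ] ℝ :=
  (1 / 2 : ℝ) • (ContinuousLinearMap.fst ℝ ℝ ℝ + ContinuousLinearMap.snd ℝ ℝ ℝ)

/-- The coordinate `(t - x) / 2`. -/
noncomputable def nullCoordY : ℝ × ℝ →L[ℝ] ℝ :=
  (1 / 2 : ℝ) • (ContinuousLinearMap.snd ℝ ℝ ℝ - ContinuousLinearMap.fst ℝ ℝ ℝ)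

/-- The linear map that takes the values `p` at `(1,1)` and `q` at `(-1,1)`. -/
noncomputable def ofNull (F : Type*) [NormedAddCommGroup F] [NormedSpace ℝ F] :
    F × F →L[ℝ] (ℝ × ℝ →L[ℝ] F) :=
  (ContinuousLinearMap.smulRightL ℝ (ℝ × ℝ) F nullCoordX).comp (ContinuousLinearMap.fst ℝ F F) +
    (ContinuousLinearMap.smulRightL ℝ (ℝ × ℝ) F nullCoordY).comp (ContinuousLinearMap.snd ℝ F F)

theorem ofNull_apply (p q : F) (v : ℝ × ℝ) :
    ofNull F (p, q) v = ((v.1 + v.2) / 2) • p + ((v.2 - v.1) / 2) • q := by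
  simp [ofNull, nullCoordX, nullCoordY, div_eq_inv_mul]
  module

theorem eq_ofNull (A : ℝ × ℝ →L[ℝ] F) : A = ofNull F (A (1, 1), A (-1, 1)) := by
  ext
  all_goals
    simp only [ContinuousLinearMap.comp_apply, ContinuousLinearMap.inl_apply,
      ContinuousLinearMap.inr_apply, ofNull_apply]
    rw [← map_smul, ← map_smul, ← map_add]
    congr 1
    ext <;> norm_num

theorem fderiv_eq_ofNull (w : ℝ × ℝ → F) (z : ℝ × ℝ) :
    fderiv ℝ w z = ofNull F (fderiv ℝ w z (1, 1), fderiv ℝ w z (-1, 1)) := eq_ofNull _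

theorem fderiv_fderiv_apply_comm {w : ℝ × ℝ → F} (hw : ContDiff ℝ ∞ w) (z v v' : ℝ × ℝ) :
    fderiv ℝ (fun y => fderiv ℝ w y v) z v' = fderiv ℝ (fun y => fderiv ℝ w y v') z v := by
  have hd : DifferentiableAt ℝ (fderiv ℝ w) z :=
    ((hw.fderiv_right (m := ∞) (by norm_num)).differentiable (by simp)) z
  rw [fderiv_clm_apply hd (differentiableAt_const v), fderiv_clm_apply hd (differentiableAt_const v')]
  simp only [fderiv_fun_const, Pi.zero_apply, ContinuousLinearMap.comp_zero, zero_add,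
    ContinuousLinearMap.flip_apply]
  exact (hw.contDiffAt.isSymmSndFDerivAt (by simpa using ENat.LEInfty.out)).eq v' v

theorem contDiff_fderiv_apply {w : ℝ × ℝ → F} (hw : ContDiff ℝ ∞ w) (v : ℝ × ℝ) :
    ContDiff ℝ ∞ (fun y => fderiv ℝ w y v) :=
  (hw.fderiv_right (by norm_num)).clm_apply contDiff_const

/-- The wave operator `∂_t² - ∂_x²`, factorized. -/
noncomputable def box (w : ℝ × ℝ → F) (z : ℝ × ℝ) : F :=
  fderiv ℝ (fun y => fderiv ℝ w y (1, 1)) z (-1, 1)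

theorem contDiff_box {w : ℝ × ℝ → F} (hw : ContDiff ℝ ∞ w) : ContDiff ℝ ∞ (box w) :=
  contDiff_fderiv_apply (contDiff_fderiv_apply hw _) _

/-- Expanding the two null derivatives leaves mixed terms, which cancel by the symmetry of second
derivatives. -/
theorem box_eq {w : ℝ × ℝ → F} (hw : ContDiff ℝ ∞ w) (z : ℝ × ℝ) :
    box w z = fderiv ℝ (fun y => fderiv ℝ w y (0, 1)) z (0, 1)
      - fderiv ℝ (fun y => fderiv ℝ w y (1, 0)) z (1, 0) := by
  have e : ((1, 1) : ℝ × ℝ) = (1, 0) + (0, 1) := by simp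
  have e' : ((-1, 1) : ℝ × ℝ) = -(1, 0) + (0, 1) := by simp
  have d : ∀ v, DifferentiableAt ℝ (fun y => fderiv ℝ w y v) z := fun v =>
    (contDiff_fderiv_apply hw v).differentiable (by simp) z
  simp only [box, e, map_add]
  rw [fderiv_fun_add (d _) (d _), add_apply, e', map_add, map_add, map_neg,
    map_neg, fderiv_fderiv_apply_comm hw z (0, 1) (1, 0)]
  abel

theorem box_sub {v w : ℝ × ℝ → F} (hv : ContDiff ℝ ∞ v) (hw : ContDiff ℝ ∞ w) (z : ℝ × ℝ) :
    box (fun y => v y - w y) z = box v z - box w z := by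
  have e : (fun y => fderiv ℝ (fun y => v y - w y) y (1, 1))
      = fun y => fderiv ℝ v y (1, 1) - fderiv ℝ w y (1, 1) := by
    funext y
    rw [fderiv_fun_sub (hv.differentiable (by simp) y) (hw.differentiable (by simp) y)]
    rfl
  simp only [box]
  rw [e, fderiv_fun_sub ((contDiff_fderiv_apply hv _).differentiable (by simp) z)
    ((contDiff_fderiv_apply hw _).differentiable (by simp) z)]
  rfl

variable [CompleteSpace F]

/-- Together with `fderiv_Y_eq` this recovers the full first derivative from initial data and
undifferentiated values of `box w`: the source of the gain of one derivative. -/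
theorem fderiv_X_eq {w : ℝ × ℝ → F} (hw : ContDiff ℝ ∞ w) (z : ℝ × ℝ) :
    fderiv ℝ w z (1, 1) = fderiv ℝ w (z.1 + 1 * z.2, 0) (1, 1) + transport 1 (box w) z :=
  eq_add_transport 1 ((contDiff_fderiv_apply hw _).of_le (by simp)) z

theorem fderiv_Y_eq {w : ℝ × ℝ → F} (hw : ContDiff ℝ ∞ w) (z : ℝ × ℝ) :
    fderiv ℝ w z (-1, 1)
      = fderiv ℝ w (z.1 + -1 * z.2, 0) (-1, 1) + transport (-1) (box w) z := by
  have h := eq_add_transport (-1) ((contDiff_fderiv_apply hw (-1, 1)).of_le (by simp)) z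
  rw [h, neg_neg]
  congr 2
  funext y
  exact fderiv_fderiv_apply_comm hw y _ _

end NullFrame

/-! ### Classical solutions by Picard iteration. -/

section Existence

variable {F : Type*} [NormedAddCommGroup F] [NormedSpace ℝ F]

/-- The value at time `t` of the datum `φ` moving with the velocity `-c`. -/
def travel (c : ℝ) (φ : ℝ → F) (z : ℝ × ℝ) : F := φ (z.1 + c * z.2)

theorem contDiff_travel (c : ℝ) {φ : ℝ → F} {n : ℕ∞ω} (hφ : ContDiff ℝ n φ) :
    ContDiff ℝ n (travel c φ) :=
  hφ.comp (by fun_prop)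

theorem fderiv_travel (c : ℝ) {φ : ℝ → F} (hφ : ContDiff ℝ ∞ φ) (z v : ℝ × ℝ) :
    fderiv ℝ (travel c φ) z v = (v.1 + c * v.2) • deriv φ (z.1 + c * z.2) := by
  have h1 : HasFDerivAt (fun z : ℝ × ℝ => z.1 + c * z.2)
      (ContinuousLinearMap.fst ℝ ℝ ℝ + c • ContinuousLinearMap.snd ℝ ℝ ℝ) z :=
    hasFDerivAt_fst.add (hasFDerivAt_snd.const_mul c)
  have h2 := ((hφ.differentiable (by simp)) (z.1 + c * z.2)).hasFDerivAt.comp z h1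
  have h3 : fderiv ℝ (travel c φ) z = _ := h2.fderiv
  rw [h3]
  simp [fderiv_eq_smul_deriv]
  module

/-- The solution of the linear problem `box w = g`, `w(·,0) = a`, `∂_t w(·,0) = b`. -/
noncomputable def linearWave (a b : ℝ → F) (g : ℝ × ℝ → F) (z : ℝ × ℝ) : F :=
  travel (-1) a z + transport (-1)
    (fun y => travel 1 (fun x => deriv a x + b x) y + transport 1 g y) z

variable {a b : ℝ → F} {g : ℝ × ℝ → F}

theorem contDiff_deriv_infty (ha : ContDiff ℝ ∞ a) : ContDiff ℝ ∞ (deriv a) :=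
  (contDiff_infty_iff_deriv.1 ha).2

theorem contDiff_linearWave_aux (ha : ContDiff ℝ ∞ a) (hb : ContDiff ℝ ∞ b) (hg : ContDiff ℝ ∞ g) :
    ContDiff ℝ ∞ (fun y => travel 1 (fun x => deriv a x + b x) y + transport 1 g y) :=
  (contDiff_travel 1 ((contDiff_deriv_infty ha).add hb)).add (contDiff_transport_infty 1 hg)

theorem contDiff_linearWave (ha : ContDiff ℝ ∞ a) (hb : ContDiff ℝ ∞ b) (hg : ContDiff ℝ ∞ g) :
    ContDiff ℝ ∞ (linearWave a b g) :=
  (contDiff_travel (-1) ha).add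
    (contDiff_transport_infty (-1) (contDiff_linearWave_aux ha hb hg))

theorem linearWave_initial (x : ℝ) : linearWave a b g (x, 0) = a x := by
  simp [linearWave, travel, transport_initial]

/-- The Picard iterates of the semilinear wave equation. -/
noncomputable def picard (a b : ℝ → F) (f : F → F) (h : ℝ × ℝ → F) : ℕ → ℝ × ℝ → F
  | 0 => fun _ => 0
  | n + 1 => linearWave a b (fun y => f (picard a b f h n y) + h y)

variable {f : F → F} {h : ℝ × ℝ → F}

theorem contDiff_picard (ha : ContDiff ℝ ∞ a) (hb : ContDiff ℝ ∞ b) (hf : ContDiff ℝ ∞ f)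
    (hh : ContDiff ℝ ∞ h) (n : ℕ) : ContDiff ℝ ∞ (picard a b f h n) := by
  induction n with
  | zero => exact contDiff_const
  | succ n ih => exact contDiff_linearWave ha hb ((hf.comp ih).add hh)

theorem linearWave_sub (ha : ContDiff ℝ ∞ a) (hb : ContDiff ℝ ∞ b) {g' : ℝ × ℝ → F}
    (hg : Continuous g) (hg' : Continuous g') (z : ℝ × ℝ) :
    linearWave a b g z - linearWave a b g' z
      = transport (-1) (transport 1 (fun y => g y - g' y)) z := by
  have c0 : Continuous (travel 1 (fun x => deriv a x + b x)) :=
    (contDiff_travel 1 ((contDiff_deriv_infty ha).add hb)).continuous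
  have e := transport_sub (-1) (c0.add (continuous_transport 1 hg))
    (c0.add (continuous_transport 1 hg')) z
  simp only [Pi.add_apply] at e
  rw [linearWave, linearWave, add_sub_add_left_eq_sub]
  refine e.symm.trans (congrArg (fun φ => transport (-1) φ z) ?_)
  funext y
  rw [transport_sub 1 hg hg', add_sub_add_left_eq_sub]

/-- The data cancel in the difference of two iterates, which leaves two transports of a difference
of values of `f`. With weight exponent `L + 1` the contraction factor is `L / (L + 1)²`, at most `1
/ 2`. -/
theorem picard_step (ha : ContDiff ℝ ∞ a) (hb : ContDiff ℝ ∞ b) (hf : ContDiff ℝ ∞ f)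
    (hh : ContDiff ℝ ∞ h) {L : NNReal} (hL : LipschitzWith L f) (T : ℝ) :
    ∃ M : ℝ, 0 ≤ M ∧ ∀ n, ∀ z ∈ diamond T, ‖picard a b f h n z - picard a b f h (n + 1) z‖
      ≤ M * (1 / 2) ^ n * Real.exp ((L + 1) * |z.2|) := by
  have hs := contDiff_picard ha hb hf hh
  obtain ⟨M, hM⟩ := (isCompact_diamond T).exists_bound_of_continuousOn
    ((hs 0).continuous.sub (hs 1).continuous).continuousOn
  have hl : (0 : ℝ) < L + 1 := by positivity
  refine ⟨|M|, abs_nonneg M, fun n => ?_⟩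
  induction n with
  | zero =>
    intro z hz
    refine (hM z hz).trans ((le_abs_self M).trans ?_)
    rw [pow_zero, mul_one]
    exact le_mul_of_one_le_right (abs_nonneg M) (Real.one_le_exp (by positivity))
  | succ n ih =>
    intro z hz
    have e := linearWave_sub ha hb ((hf.comp (hs n)).add hh).continuous
      ((hf.comp (hs (n + 1))).add hh).continuous z
    change picard a b f h (n + 1) z - picard a b f h (n + 1 + 1) z = _ at e
    rw [e]
    refine (norm_transport_le_exp hl (by simp) (fun y hy => norm_transport_le_exp hl (by simp)
      (M := L * (|M| * (1 / 2) ^ n)) (fun x hx => ?_) hy) hz).trans ?_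
    · simp only [Function.comp_apply, add_sub_add_right_eq_sub]
      rw [mul_assoc]
      exact (hL.norm_sub_le _ _).trans (by gcongr; exact ih x hx)
    · gcongr
      rw [div_div, div_le_iff₀ (by positivity), pow_succ]
      have h1 : (L : ℝ) ≤ 1 / 2 * ((L + 1) * (L + 1)) := by nlinarith [sq_nonneg (L : ℝ)]
      calc (L : ℝ) * (|M| * (1 / 2) ^ n)
          ≤ 1 / 2 * ((L + 1) * (L + 1)) * (|M| * (1 / 2) ^ n) := by gcongr
        _ = |M| * ((1 / 2) ^ n * (1 / 2)) * ((L + 1) * (L + 1)) := by ring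

variable [CompleteSpace F]

theorem fderiv_linearWave_X (ha : ContDiff ℝ ∞ a) (hb : ContDiff ℝ ∞ b) (hg : ContDiff ℝ ∞ g)
    (z : ℝ × ℝ) : fderiv ℝ (linearWave a b g) z (1, 1)
      = travel 1 (fun x => deriv a x + b x) z + transport 1 g z := by
  have h2 := contDiff_linearWave_aux ha hb hg
  have e : fderiv ℝ (linearWave a b g) z = fderiv ℝ (travel (-1) a) z + fderiv ℝ (transport (-1)
      (fun y => travel 1 (fun x => deriv a x + b x) y + transport 1 g y)) z :=
    fderiv_fun_add ((contDiff_travel (-1) ha).differentiable (by simp) z)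
      ((contDiff_transport_infty (-1) h2).differentiable (by simp) z)
  have h3 := fderiv_transport (-1) (h2.of_le (by simp)) z
  rw [neg_neg] at h3
  rw [e, add_apply, h3, fderiv_travel (-1) ha]
  simp

theorem box_linearWave (ha : ContDiff ℝ ∞ a) (hb : ContDiff ℝ ∞ b) (hg : ContDiff ℝ ∞ g)
    (z : ℝ × ℝ) : box (linearWave a b g) z = g z := by
  have hab := (contDiff_deriv_infty ha).add hb
  rw [box, funext (fderiv_linearWave_X ha hb hg),
    fderiv_fun_add ((contDiff_travel 1 hab).differentiable (by simp) z)
      ((contDiff_transport_infty 1 hg).differentiable (by simp) z), add_apply,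
    fderiv_transport 1 (hg.of_le (by simp)) z, fderiv_travel 1 hab]
  simp

omit [CompleteSpace F] in
theorem fderiv_apply_initial {w : ℝ × ℝ → F} (hw : Differentiable ℝ w)
    (h0 : ∀ x, w (x, 0) = a x) (x : ℝ) : fderiv ℝ w (x, 0) (1, 0) = deriv a x := by
  have h1 : HasDerivAt (fun x : ℝ => ((x, 0) : ℝ × ℝ)) (1, 0) x :=
    (hasDerivAt_id x).prodMk (hasDerivAt_const x 0)
  have h2 := (hw (x, 0)).hasFDerivAt.comp_hasDerivAt x h1
  rw [← h2.deriv]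
  exact congrArg (fun φ => deriv φ x) (funext h0)

theorem fderiv_linearWave_Y (ha : ContDiff ℝ ∞ a) (hb : ContDiff ℝ ∞ b) (hg : ContDiff ℝ ∞ g)
    (z : ℝ × ℝ) : fderiv ℝ (linearWave a b g) z (-1, 1)
      = travel (-1) (fun x => b x - deriv a x) z + transport (-1) g z := by
  have hw := contDiff_linearWave ha hb hg
  rw [fderiv_Y_eq hw, funext (box_linearWave ha hb hg)]
  congr 1
  -- At `t = 0` the `(1,1)`-derivative is `a' + b` and the `x`-derivative is `a'`, so the
  -- `(-1,1)`-derivative is `b - a'`.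
  have e : ((-1, 1) : ℝ × ℝ) = (1, 1) - (2 : ℝ) • (1, 0) := by ext <;> norm_num
  rw [e, map_sub, map_smul, fderiv_linearWave_X ha hb hg,
    fderiv_apply_initial (hw.differentiable (by simp)) (fun x => linearWave_initial x)]
  simp only [travel, transport_initial, mul_zero, add_zero]
  module

theorem tendstoLocallyUniformlyOn_of_diamond {G : Type*} [NormedAddCommGroup G]
    {u : ℕ → ℝ × ℝ → G} {v : ℝ × ℝ → G}
    (h : ∀ T : ℝ, ∃ C : ℝ, ∀ n, ∀ z ∈ diamond T, ‖u n z - v z‖ ≤ C * (1 / 2) ^ n) :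
    TendstoLocallyUniformlyOn u v atTop Set.univ := by
  rw [tendstoLocallyUniformlyOn_iff_forall_isCompact isOpen_univ]
  intro K _ hK
  obtain ⟨T, -, hT⟩ := exists_subset_diamond hK
  obtain ⟨C, hC⟩ := h T
  rw [Metric.tendstoUniformlyOn_iff]
  intro δ hδ
  have h0 : Tendsto (fun n : ℕ => C * (1 / 2 : ℝ) ^ n) atTop (𝓝 0) := by
    simpa using (tendsto_pow_atTop_nhds_zero_of_lt_one (by norm_num : (0 : ℝ) ≤ 1 / 2)
      (by norm_num)).const_mul C
  filter_upwards [h0.eventually_lt_const hδ] with n hn z hz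
  rw [dist_comm, dist_eq_norm]
  exact (hC n z (hT hz)).trans_lt hn

theorem exists_picard_limit (ha : ContDiff ℝ ∞ a) (hb : ContDiff ℝ ∞ b) (hf : ContDiff ℝ ∞ f)
    (hh : ContDiff ℝ ∞ h) {L : NNReal} (hL : LipschitzWith L f) :
    ∃ u : ℝ × ℝ → F, ∀ T : ℝ, ∃ C : ℝ, ∀ n, ∀ z ∈ diamond T,
      ‖picard a b f h n z - u z‖ ≤ C * (1 / 2) ^ n := by
  have key : ∀ T : ℝ, ∃ M : ℝ, ∀ z ∈ diamond T, ∀ n,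
      dist (picard a b f h n z) (picard a b f h (n + 1) z) ≤ M * (1 / 2) ^ n := by
    intro T
    obtain ⟨M, hM0, hM⟩ := picard_step ha hb hf hh hL T
    refine ⟨M * Real.exp ((L + 1) * T), fun z hz n => ?_⟩
    rw [dist_eq_norm, mul_right_comm]
    refine (hM n z hz).trans ?_
    gcongr
    exact abs_snd_le_of_mem_diamond hz
  have lim : ∀ z, ∃ y, Tendsto (fun n => picard a b f h n z) atTop (𝓝 y) := by
    intro z
    obtain ⟨M, hM⟩ := key (|z.1| + |z.2|)
    exact cauchySeq_tendsto_of_complete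
      (cauchySeq_of_le_geometric (1 / 2) M (by norm_num) (hM z (le_refl (|z.1| + |z.2|))))
  choose u hu using lim
  refine ⟨u, fun T => ?_⟩
  obtain ⟨M, hM⟩ := key T
  refine ⟨M / (1 - 1 / 2), fun n z hz => ?_⟩
  have := dist_le_of_le_geometric_of_tendsto (1 / 2) M (by norm_num) (hM z hz) (hu z) n
  rwa [dist_eq_norm, ← div_mul_eq_mul_div] at this

/-- Global existence for the semilinear wave equation with smooth data and a smooth, globally
Lipschitz nonlinearity. -/
theorem exists_smooth_solution (ha : ContDiff ℝ ∞ a) (hb : ContDiff ℝ ∞ b) (hf : ContDiff ℝ ∞ f)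
    (hh : ContDiff ℝ ∞ h) {L : NNReal} (hL : LipschitzWith L f) :
    ∃ u : ℝ × ℝ → F, ContDiff ℝ ∞ u ∧ (∀ z, box u z = f (u z) + h z) ∧
      (∀ x, u (x, 0) = a x) ∧ ∀ x, fderiv ℝ u (x, 0) (0, 1) = b x := by
  obtain ⟨u, hu⟩ := exists_picard_limit ha hb hf hh hL
  have hs := contDiff_picard ha hb hf hh
  have huc : Continuous u := by
    rw [← continuousOn_univ]
    exact (tendstoLocallyUniformlyOn_of_diamond hu).continuousOn
      (Frequently.of_forall fun n => (hs n).continuous.continuousOn)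
  have hut : ∀ z, Tendsto (fun n => picard a b f h n z) atTop (𝓝 (u z)) := fun z =>
    (tendstoLocallyUniformlyOn_of_diamond hu).tendsto_at (Set.mem_univ z)
  set g : ℝ × ℝ → F := fun y => f (u y) + h y with hg_def
  have hgc : Continuous g := (hf.continuous.comp huc).add hh.continuous
  have hgn : ∀ n, ContDiff ℝ ∞ (fun y => f (picard a b f h n y) + h y) := fun n =>
    (hf.comp (hs n)).add hh
  -- The candidates for the null derivatives of `u`; they depend on `u` only through its values.
  set p : ℝ × ℝ → F := fun z => travel 1 (fun x => deriv a x + b x) z + transport 1 g z with hp_def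
  set q : ℝ × ℝ → F := fun z => travel (-1) (fun x => b x - deriv a x) z + transport (-1) g z
    with hq_def
  have htr : ∀ T : ℝ, ∃ C : ℝ, ∀ c : ℝ, |c| ≤ 1 → ∀ n, ∀ z ∈ diamond T,
      ‖transport c (fun y => f (picard a b f h n y) + h y) z - transport c g z‖
        ≤ C * (1 / 2) ^ n := by
    intro T
    obtain ⟨C, hC⟩ := hu T
    refine ⟨T * (L * C), fun c hc n z hz => ?_⟩
    rw [← transport_sub c (hgn n).continuous hgc, mul_assoc, mul_assoc]
    refine norm_transport_le hc (fun y hy => ?_) hz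
    rw [hg_def, add_sub_add_right_eq_sub]
    exact (hL.norm_sub_le _ _).trans (by gcongr; exact hC n y hy)
  -- The null derivatives of the iterates converge locally uniformly to `p` and `q`, so the limit
  -- may be differentiated.
  have hder : ∀ z, HasFDerivAt u (ofNull F (p z, q z)) z := by
    intro z
    refine hasFDerivAt_of_tendstoLocallyUniformlyOn (l := atTop) isOpen_univ
      (f := fun n => picard a b f h (n + 1)) (f' := fun n => fderiv ℝ (picard a b f h (n + 1)))
      (g' := fun z => ofNull F (p z, q z))
      (tendstoLocallyUniformlyOn_of_diamond fun T => ?_)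
      (fun n y _ => ((hs (n + 1)).differentiable (by simp) y).hasFDerivAt)
      (fun y _ => (hut y).comp (tendsto_add_atTop_nat 1)) (Set.mem_univ z)
    obtain ⟨C, hC⟩ := htr T
    refine ⟨‖ofNull F‖ * C, fun n y hy => ?_⟩
    rw [fderiv_eq_ofNull, ← map_sub, mul_assoc]
    refine ((ofNull F).le_opNorm _).trans (mul_le_mul_of_nonneg_left ?_ (norm_nonneg _))
    have eX := fderiv_linearWave_X ha hb (hgn n) y
    have eY := fderiv_linearWave_Y ha hb (hgn n) y
    rw [picard, eX, eY, Prod.mk_sub_mk, hp_def, hq_def, add_sub_add_left_eq_sub,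
      add_sub_add_left_eq_sub]
    exact max_le (hC 1 (by simp) n y hy) (hC (-1) (by simp) n y hy)
  have hab := (contDiff_deriv_infty ha)
  -- Bootstrapping: if `u` is of class `C^n`, so are `g`, `p` and `q`, hence the derivative of `u`.
  have hk : ∀ n : ℕ, ContDiff ℝ n u := by
    intro n
    induction n with
    | zero => exact contDiff_zero.2 huc
    | succ n ih =>
      refine (contDiff_succ_iff_fderiv (n := (n : ℕ∞ω))).2
        ⟨fun z => (hder z).differentiableAt, fun h => by simp at h, ?_⟩
      rw [funext fun z => (hder z).fderiv]
      have hn : (n : ℕ∞ω) ≤ ∞ := by exact_mod_cast le_top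
      have hgk : ContDiff ℝ n g := ((hf.of_le hn).comp ih).add (hh.of_le hn)
      exact (ofNull F).contDiff.comp
        (((contDiff_travel 1 ((hab.add hb).of_le hn)).add (contDiff_transport 1 hgk)).prodMk
          ((contDiff_travel (-1) ((hb.sub hab).of_le hn)).add (contDiff_transport (-1) hgk)))
  have hu_smooth : ContDiff ℝ ∞ u := contDiff_infty.2 hk
  have hg_smooth : ContDiff ℝ ∞ g := (hf.comp hu_smooth).add hh
  have e0 : ∀ x, u (x, 0) = a x := fun x =>
    tendsto_nhds_unique ((hut (x, 0)).comp (tendsto_add_atTop_nat 1))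
      (tendsto_const_nhds.congr fun n => (linearWave_initial x).symm)
  refine ⟨u, hu_smooth, fun z => ?_, e0, fun x => ?_⟩
  · have e : (fun y => fderiv ℝ u y (1, 1)) = p := by
      funext y
      rw [(hder y).fderiv, ofNull_apply]
      norm_num
    rw [box, e, hp_def, fderiv_fun_add
      ((contDiff_travel 1 (hab.add hb)).differentiable (by simp) z)
      ((contDiff_transport_infty 1 hg_smooth).differentiable (by simp) z), add_apply,
      fderiv_transport 1 (hg_smooth.of_le (by simp)) z, fderiv_travel 1 (hab.add hb)]
    simp [hg_def]
  · rw [(hder (x, 0)).fderiv, ofNull_apply]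
    simp only [hp_def, hq_def, travel, transport_initial]
    simp only [mul_zero, add_zero, zero_add, sub_zero]
    module

end Existence

/-! ### Superposition estimates whose loss of order is uniform in the family. -/

section Estimates

variable {E : Type*} [NormedAddCommGroup E] [NormedSpace ℝ E]
variable {F : Type*} [NormedAddCommGroup F] [NormedSpace ℝ F]
variable {G : Type*} [NormedAddCommGroup G] [NormedSpace ℝ G]

theorem SupO.mono_set {w : Par → E → F} {K K' : Set E} {k : ℕ} {n : ℤ} (h : SupO w K k n)
    (hK : K' ⊆ K) : SupO w K' k n := by
  obtain ⟨C, hC⟩ := h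
  exact ⟨C, hC.mono fun ε hε x hx => hε x (hK hx)⟩

theorem SupO.sub {w w' : Par → E → F} {K : Set E} {k : ℕ} {n : ℤ}
    (sw : ∀ ε, ContDiff ℝ ∞ (w ε)) (sw' : ∀ ε, ContDiff ℝ ∞ (w' ε))
    (h : SupO w K k n) (h' : SupO w' K k n) : SupO (fun ε x => w ε x - w' ε x) K k n := by
  simp only [sub_eq_add_neg]
  exact SupO.add sw (fun ε => (sw' ε).neg) h h'.neg

theorem SupO.clm_comp (A : F →L[ℝ] G) {w : Par → E → F} (sw : ∀ ε, ContDiff ℝ ∞ (w ε))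
    {K : Set E} {k : ℕ} {n : ℤ} (h : SupO w K k n) : SupO (fun ε x => A (w ε x)) K k n := by
  obtain ⟨C, hC⟩ := h
  refine ⟨‖A‖ * C, hC.mono fun ε hε x hx => ?_⟩
  have hk : (k : ℕ∞ω) ≤ ∞ := by exact_mod_cast le_top
  refine (A.norm_iteratedFDeriv_comp_left (sw ε).contDiffAt hk).trans ?_
  rw [mul_assoc]
  gcongr
  exact hε x hx

theorem SupO.fderiv_of_succ {w : Par → E → F} {K : Set E} {k : ℕ} {n : ℤ}
    (h : SupO w K (k + 1) n) : SupO (fun ε => fderiv ℝ (w ε)) K k n :=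
  h.congr_norm fun _ _ => norm_iteratedFDeriv_fderiv

theorem SupO.succ_of_fderiv {w : Par → E → F} {K : Set E} {k : ℕ} {n : ℤ}
    (h : SupO (fun ε => fderiv ℝ (w ε)) K k n) : SupO w K (k + 1) n :=
  h.congr_norm fun _ _ => norm_iteratedFDeriv_fderiv.symm

theorem SupO.of_fixed {φ : E → F} (hφ : ContDiff ℝ ∞ φ) {K : Set E} (hK : IsCompact K) (k : ℕ) :
    SupO (fun _ => φ) K k 0 := by
  have hk : (k : ℕ∞ω) ≤ ∞ := by exact_mod_cast le_top
  obtain ⟨C, hC⟩ := hK.exists_bound_of_continuousOn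
    ((hφ.of_le hk).continuous_iteratedFDeriv le_rfl).continuousOn
  exact ⟨C, Eventually.of_forall fun ε x hx => by simpa using hC x hx⟩

/-- A superposition loses an order that depends only on the nonlinearity, the number of
derivatives and the order of the family. -/
theorem SupO.comp_le {g : F → G} (hg : PolyGrowth g) (k p : ℕ) :
    ∃ N : ℕ, ∀ (w : Par → E → F) (K : Set E), (∀ ε, ContDiff ℝ ∞ (w ε)) →
      (∀ i ≤ k, SupO w K i (-(p : ℤ))) →
      ∀ i ≤ k, SupO (fun ε x => g (w ε x)) K i (-(N : ℤ)) := by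
  obtain ⟨C, P, hC0, hC⟩ := hg.unif k
  -- `P` accounts for the growth of the derivatives of `g` at arguments of size `ε ^ (-p)`, and `k`
  -- for the at most `k` derivatives of `w` multiplied in a term of the chain rule.
  refine ⟨p * (P + k), fun w K sw hp m hm => ?_⟩
  obtain ⟨A, hA0, hA⟩ := SupO.unif hp
  refine SupO.mono (n := -((p * (P + m) : ℕ) : ℤ)) ?_
    (neg_le_neg (Nat.cast_le.2 (Nat.mul_le_mul_left p (Nat.add_le_add_left hm P))))
  refine ⟨(m.factorial : ℝ) * C * (1 + A) ^ (P + m), hA.mono fun ε hε x hx => ?_⟩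
  have h0 : (0 : ℝ) < ε := ε.2.1
  have hk : (m : ℕ∞ω) ≤ ∞ := by exact_mod_cast le_top
  set s : ℝ := (ε : ℝ) ^ (-(p : ℤ)) with hs
  have hs1 : 1 ≤ s := by
    rw [hs, zpow_neg, zpow_natCast]
    exact (one_le_inv₀ (by positivity)).2 (pow_le_one₀ h0.le ε.2.2)
  set D : ℝ := (1 + A) * s with hD
  have hD1 : 1 + A * s ≤ D := by rw [hD]; nlinarith
  have hD2 : 1 ≤ D := by nlinarith
  have hux : 1 + ‖w ε x‖ ≤ D := by
    have := hε 0 (Nat.zero_le _) x hx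
    rw [norm_iteratedFDeriv_zero] at this
    linarith
  have key := norm_iteratedFDeriv_comp_le (n := m) hg.smooth (sw ε) hk x (C := C * D ^ P) (D := D)
    (fun i hi => (hC i (hi.trans hm) _).trans (by gcongr))
    (fun i hi1 hi => by
      refine (hε i (hi.trans hm) x hx).trans ?_
      calc A * s ≤ D := by linarith
        _ ≤ D ^ i := le_self_pow₀ hD2 (by omega))
  refine key.trans (le_of_eq ?_)
  have hsp : s ^ (P + m) = (ε : ℝ) ^ (-((p * (P + m) : ℕ) : ℤ)) := by
    rw [hs, ← zpow_natCast, ← zpow_mul]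
    congr 1
    push_cast
    ring
  rw [← hsp, hD, mul_pow, mul_pow, pow_add, pow_add]
  ring

/-- The mean value inequality on a ball of radius `O(ε ^ (-p))`, where the derivative of `g` is `O(ε
^ (-p * P))`. -/
theorem SupO.comp_sub_zero {g : F → G} (hg : PolyGrowth g) (p : ℕ) :
    ∃ N : ℕ, ∀ (u v : Par → E → F) (K : Set E) (n : ℤ),
      SupO u K 0 (-(p : ℤ)) → SupO v K 0 (-(p : ℤ)) → SupO (fun ε x => u ε x - v ε x) K 0 n →
      SupO (fun ε x => g (u ε x) - g (v ε x)) K 0 (n - N) := by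
  obtain ⟨C, P, hC0, hC⟩ := hg.unif 1
  refine ⟨p * P, fun u v K n hu hv h => ?_⟩
  obtain ⟨A₁, hA₁⟩ := hu
  obtain ⟨A₂, hA₂⟩ := hv
  obtain ⟨B, hB⟩ := h
  set A := |A₁| + |A₂| with hA
  have hA0 : 0 ≤ A := by positivity
  refine ⟨C * (1 + A) ^ P * B, ((hA₁.and hA₂).and hB).mono ?_⟩
  rintro ε ⟨⟨hε₁, hε₂⟩, hεB⟩ x hx
  have h0 : (0 : ℝ) < ε := ε.2.1
  set s : ℝ := (ε : ℝ) ^ (-(p : ℤ)) with hs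
  have hs1 : 1 ≤ s := by
    rw [hs, zpow_neg, zpow_natCast]
    exact (one_le_inv₀ (by positivity)).2 (pow_le_one₀ h0.le ε.2.2)
  have hux := hε₁ x hx
  have hvx := hε₂ x hx
  have hwx := hεB x hx
  rw [norm_iteratedFDeriv_zero] at hux hvx hwx ⊢
  have hu' : ‖u ε x‖ ≤ A * s := hux.trans (by
    gcongr; linarith [le_abs_self A₁, abs_nonneg A₂])
  have hv' : ‖v ε x‖ ≤ A * s := hvx.trans (by
    gcongr; linarith [le_abs_self A₂, abs_nonneg A₁])
  have mv := (convex_closedBall (0 : F) (A * s)).norm_image_sub_le_of_norm_fderiv_le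
    (𝕜 := ℝ) (f := g) (C := C * ((1 + A) * s) ^ P) (x := v ε x) (y := u ε x)
    (fun y _ => (hg.smooth.differentiable (by simp)).differentiableAt)
    (fun y hy => by
      have hy' : ‖y‖ ≤ A * s := by simpa using hy
      have h1 := hC 1 le_rfl y
      rw [← norm_iteratedFDeriv_fderiv, norm_iteratedFDeriv_zero] at h1
      refine h1.trans ?_
      gcongr
      nlinarith)
    (by simpa using hv') (by simpa using hu')
  refine mv.trans ?_
  have hsp : s ^ P * (ε : ℝ) ^ n = (ε : ℝ) ^ (n - ((p * P : ℕ) : ℤ)) := by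
    rw [hs, ← zpow_natCast, ← zpow_mul, ← zpow_add₀ h0.ne']
    congr 1
    push_cast
    ring
  calc C * ((1 + A) * s) ^ P * ‖u ε x - v ε x‖
      ≤ C * ((1 + A) * s) ^ P * (B * (ε : ℝ) ^ n) := by gcongr
    _ = C * (1 + A) ^ P * B * (s ^ P * (ε : ℝ) ^ n) := by
        rw [mul_pow]; ring
    _ = C * (1 + A) ^ P * B * (ε : ℝ) ^ (n - ((p * P : ℕ) : ℤ)) := by rw [hsp]

end Estimates

section Superposition

universe v

variable {E : Type*} [NormedAddCommGroup E] [NormedSpace ℝ E]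
variable {F : Type v} [NormedAddCommGroup F] [NormedSpace ℝ F]

/-- The splitting `(Dg(u) - Dg(v)) Du + Dg(v) (Du - Dv)`: each summand contains one difference, with
one derivative fewer to take. -/
theorem fderiv_comp_sub_comp {G : Type*} [NormedAddCommGroup G] [NormedSpace ℝ G] {g : F → G}
    {u v : E → F} (dg : Differentiable ℝ g) (du : Differentiable ℝ u) (dv : Differentiable ℝ v)
    (y : E) : fderiv ℝ (fun x => g (u x) - g (v x)) y
      = (ContinuousLinearMap.compL ℝ E F G).flip (fderiv ℝ u y)
          (fderiv ℝ g (u y) - fderiv ℝ g (v y))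
        + ContinuousLinearMap.compL ℝ E F G (fderiv ℝ g (v y)) (fderiv ℝ u y - fderiv ℝ v y) := by
  have e1 : fderiv ℝ (fun x => g (u x)) y = (fderiv ℝ g (u y)).comp (fderiv ℝ u y) :=
    fderiv_comp y (dg _) (du y)
  have e2 : fderiv ℝ (fun x => g (v x)) y = (fderiv ℝ g (v y)).comp (fderiv ℝ v y) :=
    fderiv_comp y (dg _) (dv y)
  have e3 := fderiv_fun_sub (𝕜 := ℝ) (f := fun x => g (u x)) (g := fun x => g (v x)) (x := y)
    ((dg.comp du) y) ((dg.comp dv) y)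
  rw [e3, e1, e2]
  ext z
  simp

/-- The difference of two superpositions loses an order that depends only on the nonlinearity, the
number of derivatives and the order of the families. -/
theorem SupO.comp_sub_le (k p : ℕ) :
    ∀ (G : Type v) [NormedAddCommGroup G] [NormedSpace ℝ G] (g : F → G), PolyGrowth g →
      ∃ N : ℕ, ∀ (u v : Par → E → F) (K : Set E) (n : ℤ),
        (∀ ε, ContDiff ℝ ∞ (u ε)) → (∀ ε, ContDiff ℝ ∞ (v ε)) →
        (∀ i ≤ k, SupO u K i (-(p : ℤ))) → (∀ i ≤ k, SupO v K i (-(p : ℤ))) →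
        (∀ i ≤ k, SupO (fun ε x => u ε x - v ε x) K i n) →
        ∀ i ≤ k, SupO (fun ε x => g (u ε x) - g (v ε x)) K i (n - N) := by
  induction k with
  | zero =>
    intro G _ _ g hg
    obtain ⟨N, hN⟩ := SupO.comp_sub_zero (E := E) hg p
    refine ⟨N, fun u v K n _ _ hu hv h i hi => ?_⟩
    obtain rfl : i = 0 := by omega
    exact hN u v K n (hu 0 le_rfl) (hv 0 le_rfl) (h 0 le_rfl)
  | succ k ih =>
    intro G _ _ g hg
    have hgd := hg.fderiv
    obtain ⟨N₁, h₁⟩ := ih G g hg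
    -- The induction hypothesis is needed for the derivative of `g`, which is why the target space
    -- and the function are quantified inside the induction.
    obtain ⟨N₂, h₂⟩ := ih (F →L[ℝ] G) (fderiv ℝ g) hgd
    obtain ⟨N₃, h₃⟩ := SupO.comp_le (E := E) hgd k p
    refine ⟨N₁ + N₂ + N₃ + p, fun u v K n su sv hu hv h i hi => ?_⟩
    have hu' : ∀ i ≤ k, SupO u K i (-(p : ℤ)) := fun i hi => hu i (by omega)
    have hv' : ∀ i ≤ k, SupO v K i (-(p : ℤ)) := fun i hi => hv i (by omega)
    have h' : ∀ i ≤ k, SupO (fun ε x => u ε x - v ε x) K i n := fun i hi => h i (by omega)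
    rcases Nat.lt_or_ge k i with hki | hki
    swap
    · exact (h₁ u v K n su sv hu' hv' h' i hki).mono (by push_cast; omega)
    obtain rfl : i = k + 1 := by omega
    have d1 : ∀ ε, ContDiff ℝ ∞ (fderiv ℝ (u ε)) := fun ε => (su ε).fderiv_right (by norm_num)
    have d2 : ∀ ε, ContDiff ℝ ∞ (fderiv ℝ (v ε)) := fun ε => (sv ε).fderiv_right (by norm_num)
    have c1 : ∀ ε, ContDiff ℝ ∞ (fun x => fderiv ℝ g (u ε x)) := fun ε => hgd.smooth.comp (su ε)
    have c2 : ∀ ε, ContDiff ℝ ∞ (fun x => fderiv ℝ g (v ε x)) := fun ε => hgd.smooth.comp (sv ε)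
    have t1 : SupO (fun ε x => (ContinuousLinearMap.compL ℝ E F G).flip (fderiv ℝ (u ε) x)
        (fderiv ℝ g (u ε x) - fderiv ℝ g (v ε x))) K k (-(p : ℤ) + (n - N₂)) :=
      SupO.bilinear _ d1 (fun ε => (c1 ε).sub (c2 ε))
        (fun i hi => SupO.fderiv_of_succ (hu (i + 1) (by omega))) (h₂ u v K n su sv hu' hv' h')
    have n2 : ∀ i ≤ k, SupO (fun ε x => fderiv ℝ (u ε) x - fderiv ℝ (v ε) x) K i n := by
      intro i hi
      have e : (fun ε : Par => fun x => fderiv ℝ (u ε) x - fderiv ℝ (v ε) x)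
          = fun ε : Par => fderiv ℝ (fun x => u ε x - v ε x) := by
        funext ε x
        exact (fderiv_fun_sub ((su ε).differentiable (by simp) x)
          ((sv ε).differentiable (by simp) x)).symm
      rw [e]
      exact SupO.fderiv_of_succ (h (i + 1) (by omega))
    have t2 : SupO (fun ε x => ContinuousLinearMap.compL ℝ E F G (fderiv ℝ g (v ε x))
        (fderiv ℝ (u ε) x - fderiv ℝ (v ε) x)) K k (-(N₃ : ℤ) + n) :=
      SupO.bilinear _ c2 (fun ε => (d1 ε).sub (d2 ε)) (h₃ v K sv hv') n2
    have t := SupO.add (n := n - ((N₁ + N₂ + N₃ + p : ℕ) : ℤ))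
      (fun ε => (ContinuousLinearMap.compL ℝ E F G).flip.isBoundedBilinearMap.contDiff.comp
        ((d1 ε).prodMk ((c1 ε).sub (c2 ε))))
      (fun ε => (ContinuousLinearMap.compL ℝ E F G).isBoundedBilinearMap.contDiff.comp
        ((c2 ε).prodMk ((d1 ε).sub (d2 ε))))
      (t1.mono (by push_cast; omega)) (t2.mono (by push_cast; omega))
    refine SupO.succ_of_fderiv ?_
    have e : (fun ε => fderiv ℝ (fun x => g (u ε x) - g (v ε x))) = _ :=
      funext fun ε => funext fun y =>
      fderiv_comp_sub_comp (hg.smooth.differentiable (by simp)) ((su ε).differentiable (by simp))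
        ((sv ε).differentiable (by simp)) y
    rw [e]
    exact t

end Superposition

/-! ### Transport estimates for families and the Gronwall inequality. -/

section WaveEstimates

universe v

variable {F : Type v} [NormedAddCommGroup F] [NormedSpace ℝ F]

theorem SupO.travel_of_Icc {c T : ℝ} (hc : |c| ≤ 1) {φ : Par → ℝ → F} (sφ : ∀ ε, ContDiff ℝ ∞ (φ ε))
    {k : ℕ} {n : ℤ} (h : SupO φ (Set.Icc (-T) T) k n) :
    SupO (fun ε => travel c (φ ε)) (diamond T) k n := by
  refine SupO.pullback (w := φ) sφ
    (ContinuousLinearMap.fst ℝ ℝ ℝ + c • ContinuousLinearMap.snd ℝ ℝ ℝ) (h.mono_set ?_)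
  rintro _ ⟨z, hz, rfl⟩
  have h1 : |z.1 + c * z.2| + |(0 : ℝ)| ≤ T := foot_mem_diamond hc hz
  rw [abs_zero, add_zero, abs_le] at h1
  simpa using h1

theorem norm_charMap_le {c r : ℝ} (hc : |c| ≤ 1) (hr : r ∈ Set.Icc (0 : ℝ) 1) :
    ‖charMap c r‖ ≤ 2 := by
  refine ContinuousLinearMap.opNorm_le_bound _ (by norm_num) fun z => ?_
  rw [charMap_apply, Prod.norm_def, Prod.norm_def, Real.norm_eq_abs, Real.norm_eq_abs,
    Real.norm_eq_abs, Real.norm_eq_abs]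
  set m := max |z.1| |z.2|
  have h1 : |z.1| ≤ m := le_max_left _ _
  have h2 : |z.2| ≤ m := le_max_right _ _
  have h3 : |1 - r| ≤ 1 := abs_le.2 ⟨by linarith [hr.2], by linarith [hr.1]⟩
  have h4 : |r| ≤ 1 := abs_le.2 ⟨by linarith [hr.1], hr.2⟩
  refine max_le ?_ ?_
  · refine (abs_add_le _ _).trans ?_
    have : |c * (1 - r) * z.2| ≤ |z.2| := by
      rw [abs_mul, abs_mul]
      exact mul_le_of_le_one_left (abs_nonneg _) (mul_le_one₀ hc (abs_nonneg _) h3)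
    linarith
  · rw [abs_mul]
    have : |r| * |z.2| ≤ |z.2| := mul_le_of_le_one_left (abs_nonneg _) h4
    linarith [abs_nonneg z.2]

/-- The maps `charMap c r` preserve the diamond and have norm at most `2`, so neither the domain nor
the power of `ε` deteriorates. -/
theorem SupO.integral_charMap {c T : ℝ} (hc : |c| ≤ 1) {g : Par → ℝ × ℝ → F}
    (sg : ∀ ε, ContDiff ℝ ∞ (g ε)) {k : ℕ} {n : ℤ} (h : SupO g (diamond T) k n) :
    SupO (fun ε z => ∫ r in (0 : ℝ)..1, g ε (charMap c r z)) (diamond T) k n := by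
  obtain ⟨C, hC⟩ := h
  have hk : (k : ℕ∞ω) ≤ ∞ := by exact_mod_cast le_top
  refine ⟨C * 2 ^ k, hC.mono fun ε hε z hz => ?_⟩
  refine norm_iteratedFDeriv_integral_zero_one_le k
    (G := fun y : (ℝ × ℝ) × ℝ => g ε (charMap c y.2 y.1)) (contDiff_comp_charMap c (sg ε))
    fun r hr => ?_
  have e : iteratedFDeriv ℝ k (fun y => g ε (charMap c r y)) z
      = (iteratedFDeriv ℝ k (g ε) (charMap c r z)).compContinuousLinearMap
        fun _ => charMap c r :=
    (charMap c r).iteratedFDeriv_comp_right (sg ε) z hk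
  rw [e]
  refine (ContinuousMultilinearMap.norm_compContinuousLinearMap_le _ _).trans ?_
  rw [Finset.prod_const, Finset.card_univ, Fintype.card_fin, mul_right_comm]
  have hb := hε _ (charMap_mem_diamond hc hr hz)
  exact mul_le_mul hb (pow_le_pow_left₀ (norm_nonneg _) (norm_charMap_le hc hr) k)
    (by positivity) ((norm_nonneg _).trans hb)

theorem contDiff_integral_charMap (c : ℝ) {g : ℝ × ℝ → F} (sg : ContDiff ℝ ∞ g) :
    ContDiff ℝ ∞ (fun z => ∫ r in (0 : ℝ)..1, g (charMap c r z)) :=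
  contDiff_infty.2 fun m => contDiff_integral_zero_one m
    (G := fun y : (ℝ × ℝ) × ℝ => g (charMap c y.2 y.1))
    (contDiff_comp_charMap c (sg.of_le (by exact_mod_cast le_top)))

theorem SupO.transport_of_le {c T : ℝ} (hc : |c| ≤ 1) {g : Par → ℝ × ℝ → F}
    (sg : ∀ ε, ContDiff ℝ ∞ (g ε)) {k : ℕ} {n : ℤ} (h : ∀ i ≤ k, SupO g (diamond T) i n) :
    SupO (fun ε => transport c (g ε)) (diamond T) k n := by
  have hb := SupO.bilinear (ContinuousLinearMap.lsmul ℝ ℝ) (w := fun _ (z : ℝ × ℝ) => z.2)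
    (fun _ => contDiff_snd) (fun ε => contDiff_integral_charMap c (sg ε))
    (fun i _ => SupO.of_fixed contDiff_snd (isCompact_diamond T) i)
    (fun i hi => SupO.integral_charMap hc sg (h i hi))
  rw [zero_add] at hb
  refine hb.congr_norm fun ε x => ?_
  rw [funext (transport_eq_smul c (g ε))]
  rfl

variable [CompleteSpace F]

/-- Gronwall's inequality for the wave operator on a domain of determinacy. -/
theorem norm_le_of_norm_box_le {w : ℝ × ℝ → F} (hw : ContDiff ℝ ∞ w) {T L A H : ℝ} (hL : 0 ≤ L)
    (hH : 0 ≤ H) (hbox : ∀ z ∈ diamond T, ‖box w z‖ ≤ L * ‖w z‖ + H)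
    (h0 : ∀ x ∈ Set.Icc (-T) T, ‖w (x, 0)‖ ≤ A)
    (h1 : ∀ x ∈ Set.Icc (-T) T, ‖fderiv ℝ w (x, 0) (1, 1)‖ ≤ A) {z : ℝ × ℝ}
    (hz : z ∈ diamond T) : ‖w z‖ ≤ 2 * Real.exp (2 * (L + 1) * T) * (A + H) := by
  -- Chosen so that `1 / l` and `L / l` are at most `1 / 2`; half of the weighted maximum `M` can
  -- then be absorbed.
  set l : ℝ := 2 * (L + 1) with hl_def
  have hl : 0 < l := by positivity
  have hX := contDiff_fderiv_apply hw (1, 1)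
  have foot : ∀ c : ℝ, |c| ≤ 1 → ∀ y ∈ diamond T, y.1 + c * y.2 ∈ Set.Icc (-T) T := by
    intro c hc y hy
    have h : |y.1 + c * y.2| + |(0 : ℝ)| ≤ T := foot_mem_diamond hc hy
    rwa [abs_zero, add_zero, abs_le] at h
  have hcont : Continuous fun y : ℝ × ℝ =>
      max ‖w y‖ ‖fderiv ℝ w y (1, 1)‖ * Real.exp (-(l * |y.2|)) :=
    (hw.continuous.norm.max hX.continuous.norm).mul (by fun_prop)
  -- Evaluating both characteristic formulas at a maximum point of the weighted norm gives `M ≤ A +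
  -- H + M / 2`.
  obtain ⟨y₀, hy₀, hmax⟩ := (isCompact_diamond T).exists_isMaxOn ⟨z, hz⟩ hcont.continuousOn
  set M := max ‖w y₀‖ ‖fderiv ℝ w y₀ (1, 1)‖ * Real.exp (-(l * |y₀.2|)) with hM
  have hM0 : 0 ≤ M := by positivity
  have hbd : ∀ y ∈ diamond T, max ‖w y‖ ‖fderiv ℝ w y (1, 1)‖ ≤ M * Real.exp (l * |y.2|) := by
    intro y hy
    have h : max ‖w y‖ ‖fderiv ℝ w y (1, 1)‖ * Real.exp (-(l * |y.2|)) ≤ M := hmax hy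
    rwa [Real.exp_neg, ← div_eq_mul_inv, div_le_iff₀ (Real.exp_pos _)] at h
  have hA : 0 ≤ A := (norm_nonneg _).trans (h0 _ (foot 1 (by simp) z hz))
  have step : max ‖w y₀‖ ‖fderiv ℝ w y₀ (1, 1)‖ ≤ (A + H + M / 2) * Real.exp (l * |y₀.2|) := by
    have he : 1 ≤ Real.exp (l * |y₀.2|) := Real.one_le_exp (by positivity)
    refine max_le ?_ ?_
    · have e := eq_add_transport (-1) (hw.of_le (by simp)) y₀
      rw [neg_neg] at e
      rw [e]
      refine (norm_add_le _ _).trans ((add_le_add (h0 _ (foot (-1) (by simp) y₀ hy₀))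
        (norm_transport_le_exp hl (by simp)
          (fun y hy => (le_max_right _ _).trans (hbd y hy)) hy₀)).trans ?_)
      have h2 : M / l ≤ M / 2 := by
        gcongr
        linarith
      calc A + M / l * Real.exp (l * |y₀.2|)
          ≤ A * Real.exp (l * |y₀.2|) + M / 2 * Real.exp (l * |y₀.2|) := by
            gcongr
            exact le_mul_of_one_le_right hA he
        _ ≤ (A + H + M / 2) * Real.exp (l * |y₀.2|) := by
            rw [← add_mul]
            gcongr
            linarith
    · rw [fderiv_X_eq hw]
      refine (norm_add_le _ _).trans ((add_le_add (h1 _ (foot 1 (by simp) y₀ hy₀))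
        (norm_transport_le_exp hl (by simp) (M := L * M + H) (fun y hy => ?_) hy₀)).trans ?_)
      · have h3 := (le_max_left _ _).trans (hbd y hy)
        have h4 : 1 ≤ Real.exp (l * |y.2|) := Real.one_le_exp (by positivity)
        calc ‖box w y‖ ≤ L * ‖w y‖ + H := hbox y hy
          _ ≤ L * (M * Real.exp (l * |y.2|)) + H * Real.exp (l * |y.2|) := by
            gcongr
            exact le_mul_of_one_le_right hH h4
          _ = (L * M + H) * Real.exp (l * |y.2|) := by ring
      · have h2 : (L * M + H) / l ≤ M / 2 + H := by
          rw [div_le_iff₀ hl, hl_def]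
          nlinarith [mul_nonneg hL hH]
        calc A + (L * M + H) / l * Real.exp (l * |y₀.2|)
            ≤ A * Real.exp (l * |y₀.2|) + (M / 2 + H) * Real.exp (l * |y₀.2|) := by
              gcongr
              exact le_mul_of_one_le_right hA he
          _ = (A + H + M / 2) * Real.exp (l * |y₀.2|) := by ring
  have hM2 : M ≤ 2 * (A + H) := by
    have h := (div_le_iff₀ (Real.exp_pos _)).2 step
    rw [div_eq_mul_inv, ← Real.exp_neg, ← hM] at h
    linarith
  calc ‖w z‖ ≤ M * Real.exp (l * |z.2|) := (le_max_left _ _).trans (hbd z hz)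
    _ ≤ 2 * (A + H) * Real.exp (l * T) := by
      gcongr
      exact abs_snd_le_of_mem_diamond hz
    _ = 2 * Real.exp (l * T) * (A + H) := by ring

end WaveEstimates

/-! ### Moderateness and stability of families of solutions. -/

section WaveFamilies

universe v

variable {F : Type v} [NormedAddCommGroup F] [NormedSpace ℝ F]

/-- The family of the initial positions. -/
def positionFamily (w : Par → ℝ × ℝ → F) (ε : Par) (x : ℝ) : F := w ε (x, 0)

/-- The family of the initial velocities. -/
noncomputable def velocityFamily (w : Par → ℝ × ℝ → F) (ε : Par) (x : ℝ) : F :=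
  fderiv ℝ (w ε) (x, 0) (0, 1)

variable {w : Par → ℝ × ℝ → F} (sw : ∀ ε, ContDiff ℝ ∞ (w ε))
include sw

theorem contDiff_positionFamily (ε : Par) : ContDiff ℝ ∞ (positionFamily w ε) :=
  (sw ε).comp (contDiff_id.prodMk contDiff_const)

theorem contDiff_velocityFamily (ε : Par) : ContDiff ℝ ∞ (velocityFamily w ε) :=
  (contDiff_fderiv_apply (sw ε) (0, 1)).comp (contDiff_id.prodMk contDiff_const)

theorem contDiff_fderiv_positionFamily (ε : Par) :
    ContDiff ℝ ∞ (fun x => fderiv ℝ (positionFamily w ε) x 1) :=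
  ((contDiff_positionFamily sw ε).fderiv_right (by norm_num)).clm_apply contDiff_const

theorem fderiv_positionFamily (ε : Par) (x : ℝ) :
    fderiv ℝ (positionFamily w ε) x 1 = fderiv ℝ (w ε) (x, 0) (1, 0) := by
  rw [fderiv_apply_one_eq_deriv]
  exact (fderiv_apply_initial ((sw ε).differentiable (by simp)) (fun _ => rfl) x).symm

theorem fderiv_X_initial (ε : Par) (x : ℝ) : fderiv ℝ (w ε) (x, 0) (1, 1)
    = fderiv ℝ (positionFamily w ε) x 1 + velocityFamily w ε x := by
  rw [fderiv_positionFamily sw, velocityFamily, ← map_add]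
  simp

theorem fderiv_Y_initial (ε : Par) (x : ℝ) : fderiv ℝ (w ε) (x, 0) (-1, 1)
    = velocityFamily w ε x - fderiv ℝ (positionFamily w ε) x 1 := by
  rw [fderiv_positionFamily sw, velocityFamily, ← map_sub]
  simp

variable {T : ℝ} {k : ℕ} {n : ℤ}

theorem SupO.fderiv_X_initial (ha : SupO (positionFamily w) (Set.Icc (-T) T) (k + 1) n)
    (hb : SupO (velocityFamily w) (Set.Icc (-T) T) k n) :
    SupO (fun ε x => fderiv ℝ (w ε) (x, 0) (1, 1)) (Set.Icc (-T) T) k n := by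
  simp only [Colombeau.fderiv_X_initial sw]
  exact SupO.add (contDiff_fderiv_positionFamily sw) (contDiff_velocityFamily sw)
    (ha.fderiv_of_succ.clm_apply
      (fun ε => (contDiff_positionFamily sw ε).fderiv_right (by norm_num)) 1) hb

theorem SupO.fderiv_Y_initial (ha : SupO (positionFamily w) (Set.Icc (-T) T) (k + 1) n)
    (hb : SupO (velocityFamily w) (Set.Icc (-T) T) k n) :
    SupO (fun ε x => fderiv ℝ (w ε) (x, 0) (-1, 1)) (Set.Icc (-T) T) k n := by
  simp only [Colombeau.fderiv_Y_initial sw]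
  exact SupO.sub (contDiff_velocityFamily sw) (contDiff_fderiv_positionFamily sw) hb
    (ha.fderiv_of_succ.clm_apply
      (fun ε => (contDiff_positionFamily sw ε).fderiv_right (by norm_num)) 1)

variable [CompleteSpace F]

/-- The constant `L` does not depend on `ε`, so the exponential factor from Gronwall's inequality is
a constant and the order `n` is preserved. -/
theorem SupO.zero_of_norm_box_le {L : ℝ} (hL : 0 ≤ L)
    (ha : ∀ i ≤ 1, SupO (positionFamily w) (Set.Icc (-T) T) i n)
    (hb : SupO (velocityFamily w) (Set.Icc (-T) T) 0 n)
    (hbox : ∃ C : ℝ, ∀ᶠ ε : Par in toZero, ∀ z ∈ diamond T,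
      ‖box (w ε) z‖ ≤ L * ‖w ε z‖ + C * (ε : ℝ) ^ n) : SupO w (diamond T) 0 n := by
  obtain ⟨A, hA⟩ := ha 0 zero_le_one
  obtain ⟨B, hB⟩ := SupO.fderiv_X_initial sw (ha 1 le_rfl) hb
  obtain ⟨C, hC⟩ := hbox
  refine ⟨2 * Real.exp (2 * (L + 1) * T) * (max A B + |C|),
    ((hA.and hB).and hC).mono ?_⟩
  rintro ε ⟨⟨hεA, hεB⟩, hεC⟩ z hz
  have h0 : (0 : ℝ) < ε := ε.2.1
  simp only [norm_iteratedFDeriv_zero] at hεA hεB ⊢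
  have hn : (0 : ℝ) ≤ (ε : ℝ) ^ n := by positivity
  rw [mul_assoc, add_mul]
  refine norm_le_of_norm_box_le (sw ε) hL (mul_nonneg (abs_nonneg C) hn)
    (fun z hz => (hεC z hz).trans (add_le_add le_rfl
      (mul_le_mul_of_nonneg_right (le_abs_self C) hn)))
    (fun x hx => (hεA x hx).trans (mul_le_mul_of_nonneg_right (le_max_left A B) hn))
    (fun x hx => (hεB x hx).trans (mul_le_mul_of_nonneg_right (le_max_right A B) hn)) hz

/-- The wave equation gains one derivative. -/
theorem SupO.succ_of_box (ha : ∀ i ≤ k + 1, SupO (positionFamily w) (Set.Icc (-T) T) i n)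
    (hb : ∀ i ≤ k, SupO (velocityFamily w) (Set.Icc (-T) T) i n)
    (hbox : ∀ i ≤ k, SupO (fun ε => box (w ε)) (diamond T) i n) :
    SupO w (diamond T) (k + 1) n := by
  have sX : ∀ ε, ContDiff ℝ ∞ (fun x => fderiv ℝ (w ε) (x, 0) (1, 1)) := fun ε =>
    (contDiff_fderiv_apply (sw ε) (1, 1)).comp (contDiff_id.prodMk contDiff_const)
  have sY : ∀ ε, ContDiff ℝ ∞ (fun x => fderiv ℝ (w ε) (x, 0) (-1, 1)) := fun ε =>
    (contDiff_fderiv_apply (sw ε) (-1, 1)).comp (contDiff_id.prodMk contDiff_const)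
  have sb := fun ε => contDiff_box (sw ε)
  have hX : SupO (fun ε z => fderiv ℝ (w ε) z (1, 1)) (diamond T) k n := by
    rw [show (fun ε z => fderiv ℝ (w ε) z (1, 1)) = _ from
      funext fun ε => funext (fderiv_X_eq (sw ε))]
    exact SupO.add (fun ε => contDiff_travel 1 (sX ε))
      (fun ε => contDiff_transport_infty 1 (sb ε))
      (SupO.travel_of_Icc (by simp) sX
        (SupO.fderiv_X_initial sw (ha (k + 1) le_rfl) (hb k le_rfl)))
      (SupO.transport_of_le (by simp) sb hbox)
  have hY : SupO (fun ε z => fderiv ℝ (w ε) z (-1, 1)) (diamond T) k n := by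
    rw [show (fun ε z => fderiv ℝ (w ε) z (-1, 1)) = _ from
      funext fun ε => funext (fderiv_Y_eq (sw ε))]
    exact SupO.add (fun ε => contDiff_travel (-1) (sY ε))
      (fun ε => contDiff_transport_infty (-1) (sb ε))
      (SupO.travel_of_Icc (by simp) sY
        (SupO.fderiv_Y_initial sw (ha (k + 1) le_rfl) (hb k le_rfl)))
      (SupO.transport_of_le (by simp) sb hbox)
  refine SupO.succ_of_fderiv ?_
  have e : (fun ε => fderiv ℝ (w ε)) = fun ε z =>
      (ofNull F).comp (ContinuousLinearMap.inl ℝ F F) (fderiv ℝ (w ε) z (1, 1))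
        + (ofNull F).comp (ContinuousLinearMap.inr ℝ F F) (fderiv ℝ (w ε) z (-1, 1)) := by
    funext ε z
    refine (fderiv_eq_ofNull (w ε) z).trans ?_
    simp only [ContinuousLinearMap.comp_apply, ContinuousLinearMap.inl_apply,
      ContinuousLinearMap.inr_apply]
    rw [← map_add]
    simp
  rw [e]
  have cX := fun ε => contDiff_fderiv_apply (sw ε) (1, 1)
  have cY := fun ε => contDiff_fderiv_apply (sw ε) (-1, 1)
  exact SupO.add (fun ε => ((ofNull F).comp (ContinuousLinearMap.inl ℝ F F)).contDiff.comp (cX ε))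
    (fun ε => ((ofNull F).comp (ContinuousLinearMap.inr ℝ F F)).contDiff.comp (cY ε))
    (hX.clm_comp _ cX) (hY.clm_comp _ cY)

omit sw

variable {f : F → F} {L : NNReal}

/-- Gronwall's inequality starts the induction at order zero; afterwards the gain of one derivative
carries bounds of order at most `k` for `f(u) + h` to order `k + 1` for `u`. -/
theorem isModerate_of_box (hf : PolyGrowth f) (hL : LipschitzWith L f) (hf0 : f 0 = 0)
    {u h : Par → ℝ × ℝ → F} (su : ∀ ε, ContDiff ℝ ∞ (u ε)) (sh : ∀ ε, ContDiff ℝ ∞ (h ε))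
    (hbox : ∀ ε z, box (u ε) z = f (u ε z) + h ε z) (ha : IsModerate (positionFamily u))
    (hb : IsModerate (velocityFamily u)) (hh : IsModerate h) : IsModerate u := by
  have key : ∀ (T : ℝ) (k : ℕ), ∃ p : ℕ, ∀ i ≤ k, SupO u (diamond T) i (-(p : ℤ)) := by
    intro T k
    induction k with
    | zero =>
      obtain ⟨p₁, h₁⟩ := ha.unif (isCompact_Icc (a := -T) (b := T)) 1
      obtain ⟨p₂, h₂⟩ := hb (Set.Icc (-T) T) isCompact_Icc 0
      obtain ⟨p₃, h₃⟩ := hh (diamond T) (isCompact_diamond T) 0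
      refine ⟨p₁ + p₂ + p₃, fun i hi => ?_⟩
      obtain rfl : i = 0 := by omega
      refine SupO.zero_of_norm_box_le su L.2
        (fun i hi => (h₁ i hi).mono (by push_cast; omega)) (h₂.mono (by push_cast; omega)) ?_
      obtain ⟨C, hC⟩ := h₃.mono (m := -((p₁ + p₂ + p₃ : ℕ) : ℤ)) (by push_cast; omega)
      refine ⟨C, hC.mono fun ε hε z hz => ?_⟩
      have h1 := hε z hz
      rw [norm_iteratedFDeriv_zero] at h1
      rw [hbox]
      refine (norm_add_le _ _).trans (add_le_add ?_ h1)
      -- Here `f 0 = 0` turns the Lipschitz condition into the linear bound `‖f(u)‖ ≤ L ‖u‖`.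
      simpa [hf0] using hL.norm_sub_le (u ε z) 0
    | succ k ih =>
      obtain ⟨p, hp⟩ := ih
      obtain ⟨N, hN⟩ := SupO.comp_le (E := ℝ × ℝ) hf k p
      obtain ⟨p₁, h₁⟩ := ha.unif (isCompact_Icc (a := -T) (b := T)) (k + 1)
      obtain ⟨p₂, h₂⟩ := hb.unif (isCompact_Icc (a := -T) (b := T)) k
      obtain ⟨p₃, h₃⟩ := hh.unif (isCompact_diamond T) k
      refine ⟨p + N + p₁ + p₂ + p₃, fun i hi => ?_⟩
      rcases Nat.lt_or_ge k i with hki | hki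
      swap
      · exact (hp i hki).mono (by push_cast; omega)
      obtain rfl : i = k + 1 := by omega
      refine SupO.succ_of_box su (fun i hi => (h₁ i hi).mono (by push_cast; omega))
        (fun i hi => (h₂ i hi).mono (by push_cast; omega)) fun i hi => ?_
      rw [show (fun ε => box (u ε)) = fun ε z => f (u ε z) + h ε z from
        funext fun ε => funext (hbox ε)]
      exact SupO.add (fun ε => hf.smooth.comp (su ε)) sh
        ((hN u _ su hp i hi).mono (by push_cast; omega)) ((h₃ i hi).mono (by push_cast; omega))
  intro K hK k
  obtain ⟨T, -, hT⟩ := exists_subset_diamond hK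
  obtain ⟨p, hp⟩ := key T k
  exact ⟨p, (hp k le_rfl).mono_set hT⟩

/-- Stability of the semilinear wave equation: a family that is close to a moderate family `u` in
its initial data and its residual is close to `u`. -/
theorem SupO.stability (hf : PolyGrowth f) (hL : LipschitzWith L f) {u : Par → ℝ × ℝ → F}
    (su : ∀ ε, ContDiff ℝ ∞ (u ε)) (hu : IsModerate u) (T : ℝ) (m : ℕ) :
    ∀ p : ℕ, ∃ q : ℕ, ∀ v : Par → ℝ × ℝ → F, (∀ ε, ContDiff ℝ ∞ (v ε)) →
      (∀ i ≤ m + 1, SupO (positionFamily fun ε z => u ε z - v ε z) (Set.Icc (-T) T) i (q : ℤ)) →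
      (∀ i ≤ m + 1, SupO (velocityFamily fun ε z => u ε z - v ε z) (Set.Icc (-T) T) i (q : ℤ)) →
      (∀ i ≤ m, SupO (fun ε z => (box (u ε) z - f (u ε z)) - (box (v ε) z - f (v ε z)))
        (diamond T) i (q : ℤ)) →
      ∀ i ≤ m, SupO (fun ε z => u ε z - v ε z) (diamond T) i (p : ℤ) := by
  have ebox : ∀ v : Par → ℝ × ℝ → F, (∀ ε, ContDiff ℝ ∞ (v ε)) → ∀ ε z,
      box (fun z => u ε z - v ε z) z = (f (u ε z) - f (v ε z))
        + ((box (u ε) z - f (u ε z)) - (box (v ε) z - f (v ε z))) := by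
    intro v sv ε z
    rw [box_sub (su ε) (sv ε)]
    abel
  induction m with
  | zero =>
    refine fun p => ⟨p, fun v sv ha hb hh i hi => ?_⟩
    obtain rfl : i = 0 := by omega
    refine SupO.zero_of_norm_box_le (fun ε => (su ε).sub (sv ε)) L.2 ha (hb 0 (by omega)) ?_
    obtain ⟨C, hC⟩ := hh 0 le_rfl
    refine ⟨C, hC.mono fun ε hε z hz => ?_⟩
    have h1 := hε z hz
    rw [norm_iteratedFDeriv_zero] at h1
    rw [ebox v sv]
    exact (norm_add_le _ _).trans (add_le_add (hL.norm_sub_le _ _) h1)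
  | succ m ih =>
    intro p
    obtain ⟨P, hP⟩ := hu.unif (isCompact_diamond T) m
    obtain ⟨N, hN⟩ := SupO.comp_sub_le (E := ℝ × ℝ) m P F f hf
    -- Passing from `u - v` to `f(u) - f(v)` costs `N` powers of `ε`, so the lower orders are
    -- requested with accuracy `p + N`. Both `P` and `N` are determined before `v` appears.
    obtain ⟨q, hq⟩ := ih (p + N)
    refine ⟨p + q, fun v sv ha hb hh i hi => ?_⟩
    have sw : ∀ ε, ContDiff ℝ ∞ (fun z => u ε z - v ε z) := fun ε => (su ε).sub (sv ε)
    have hw := hq v sv (fun i hi => (ha i (by omega)).mono (by push_cast; omega))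
      (fun i hi => (hb i (by omega)).mono (by push_cast; omega))
      (fun i hi => (hh i (by omega)).mono (by push_cast; omega))
    rcases Nat.lt_or_ge m i with hmi | hmi
    swap
    · exact (hw i hmi).mono (by push_cast; omega)
    obtain rfl : i = m + 1 := by omega
    -- `v` inherits the growth of `u` because `u - v` is already known to be small.
    have hv : ∀ i ≤ m, SupO v (diamond T) i (-(P : ℤ)) := by
      intro i hi
      have h := SupO.sub su sw (hP i hi) ((hw i hi).mono (by push_cast; omega))
      simpa only [sub_sub_cancel] using h
    have hfd := hN u v (diamond T) ((p + N : ℕ) : ℤ) su sv hP hv hw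
    refine SupO.succ_of_box sw (fun i hi => (ha i (by omega)).mono (by push_cast; omega))
      (fun i hi => (hb i (by omega)).mono (by push_cast; omega)) fun i hi => ?_
    rw [show (fun ε => box (fun z => u ε z - v ε z)) = _ from
      funext fun ε => funext (ebox v sv ε)]
    exact SupO.add (fun ε => (hf.smooth.comp (su ε)).sub (hf.smooth.comp (sv ε)))
      (fun ε => ((contDiff_box (su ε)).sub (hf.smooth.comp (su ε))).sub
        ((contDiff_box (sv ε)).sub (hf.smooth.comp (sv ε))))
      ((hfd i hi).mono (by push_cast; omega)) ((hh i (by omega)).mono (by push_cast; omega))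

end WaveFamilies

/-! ### Neighbourhoods in the sharp topology. -/

section SharpTopology

variable {E : Type*} [NormedAddCommGroup E] [NormedSpace ℝ E]
variable {𝕜 : Type*} [RCLike 𝕜]

/-- Two representatives differ by a null family, which is `O(ε ^ p)` on the compact set `K`; so the
estimate passes from one representative to all. -/
theorem SupO.of_mk_mem_sharpNhd {K : Set E} (hK : IsCompact K) {m p : ℕ} {r : Moderate E 𝕜}
    (h : GenFun.mk r ∈ sharpNhd K m p) {k : ℕ} (hk : k ≤ m) :
    SupO (r : Par → E → 𝕜) K k (p : ℤ) := by
  obtain ⟨s, hs, hp⟩ := h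
  have hn := GenFun.mk_eq_mk.1 hs.symm
  have h1 := SupO.add (fun ε => (r.2.1 ε).sub (s.2.1 ε)) s.2.1 (hn K hK k p) (hp k hk)
  simpa only [sub_add_cancel] using h1

theorem neg_mem_sharpNhd {K : Set E} {m p : ℕ} {u : GenFun E 𝕜} (h : u ∈ sharpNhd K m p) :
    -u ∈ sharpNhd K m p := by
  obtain ⟨r, rfl, hr⟩ := h
  exact ⟨-r, GenFun.mk_neg r, fun k hk => (hr k hk).neg⟩

theorem eventually_sub_mem_sharpNhd (u : GenFun E 𝕜) {K : Set E} (hK : IsCompact K) (m p : ℕ) :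
    ∀ᶠ v in 𝓝 u, u - v ∈ sharpNhd K m p := by
  refine ((sharpBasis E 𝕜).nhds_hasBasis u).mem_iff.2 ⟨_, ⟨K, m, p, hK, rfl⟩, ?_⟩
  rintro _ ⟨y, hy, rfl⟩
  simpa using neg_mem_sharpNhd hy

theorem exists_sharpNhd_of_mem_nhds {u : GenFun E 𝕜} {U : Set (GenFun E 𝕜)} (hU : U ∈ 𝓝 u) :
    ∃ (K : Set E) (m p : ℕ), IsCompact K ∧ ∀ v, u - v ∈ sharpNhd K m p → v ∈ U := by
  obtain ⟨_, ⟨K, m, p, hK, rfl⟩, h⟩ := ((sharpBasis E 𝕜).nhds_hasBasis u).mem_iff.1 hU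
  exact ⟨K, m, p, hK, fun v hv => h ⟨-(u - v), neg_mem_sharpNhd hv, by simp⟩⟩

end SharpTopology

/-! ### The Cauchy problem in the Colombeau algebra. -/

section WaveProblem

variable {𝕜 : Type*} [RCLike 𝕜]

/-- The family `∂_t² r - ∂_x² r - f(r)`. -/
noncomputable def residual (f : 𝕜 → 𝕜) (hf : PolyGrowth f) (r : Moderate (ℝ × ℝ) 𝕜) :
    Moderate (ℝ × ℝ) 𝕜 :=
  Moderate.dir (0, 1) (Moderate.dir (0, 1) r) - Moderate.dir (1, 0) (Moderate.dir (1, 0) r)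
    - Moderate.superpose f hf r

/-- The initial position of a moderate family. -/
noncomputable def initialPosition (r : Moderate (ℝ × ℝ) 𝕜) : Moderate ℝ 𝕜 :=
  Moderate.pullback (ContinuousLinearMap.inl ℝ ℝ ℝ) r

/-- The initial velocity of a moderate family. -/
noncomputable def initialVelocity (r : Moderate (ℝ × ℝ) 𝕜) : Moderate ℝ 𝕜 :=
  Moderate.pullback (ContinuousLinearMap.inl ℝ ℝ ℝ) (Moderate.dir (0, 1) r)

variable {f : 𝕜 → 𝕜} {hf : PolyGrowth f}

theorem residual_apply (r : Moderate (ℝ × ℝ) 𝕜) (ε : Par) (z : ℝ × ℝ) :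
    (residual f hf r : Par → ℝ × ℝ → 𝕜) ε z
      = box ((r : Par → ℝ × ℝ → 𝕜) ε) z - f ((r : Par → ℝ × ℝ → 𝕜) ε z) := by
  rw [box_eq (r.2.1 ε)]
  rfl

/-- Every moderate family solves the problem whose data are its own residual and initial values, so
the data may be replaced by those of a representative of the solution. -/
theorem isWaveSolution_mk_iff {a b : GenFun ℝ 𝕜} {h : GenFun (ℝ × ℝ) 𝕜}
    {r : Moderate (ℝ × ℝ) 𝕜} : IsWaveSolution f hf a b h (GenFun.mk r) ↔
      GenFun.mk (residual f hf r) = h ∧ GenFun.mk (initialPosition r) = a ∧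
        GenFun.mk (initialVelocity r) = b := by
  have e : GenFun.mk (residual f hf r) = dt (dt (GenFun.mk r)) - dx (dx (GenFun.mk r))
      - GenFun.superpose f hf (GenFun.mk r) := rfl
  constructor
  · rintro ⟨h1, h2, h3⟩
    exact ⟨by rw [e, h1, add_sub_cancel_left], h2, h3⟩
  · rintro ⟨h1, h2, h3⟩
    exact ⟨by rw [← h1, e, add_sub_cancel], h2, h3⟩

theorem positionFamily_sub (r s : Moderate (ℝ × ℝ) 𝕜) :
    positionFamily (fun ε z => (r : Par → ℝ × ℝ → 𝕜) ε z - (s : Par → ℝ × ℝ → 𝕜) ε z)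
      = ((initialPosition r - initialPosition s : Moderate ℝ 𝕜) : Par → ℝ → 𝕜) := rfl

theorem velocityFamily_sub (r s : Moderate (ℝ × ℝ) 𝕜) :
    velocityFamily (fun ε z => (r : Par → ℝ × ℝ → 𝕜) ε z - (s : Par → ℝ × ℝ → 𝕜) ε z)
      = ((initialVelocity r - initialVelocity s : Moderate ℝ 𝕜) : Par → ℝ → 𝕜) := by
  funext ε x
  rw [velocityFamily, fderiv_fun_sub ((r.2.1 ε).differentiable (by simp) _)
    ((s.2.1 ε).differentiable (by simp) _)]
  rfl

theorem residual_sub (r s : Moderate (ℝ × ℝ) 𝕜) :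
    (fun ε z => (box ((r : Par → ℝ × ℝ → 𝕜) ε) z - f ((r : Par → ℝ × ℝ → 𝕜) ε z))
        - (box ((s : Par → ℝ × ℝ → 𝕜) ε) z - f ((s : Par → ℝ × ℝ → 𝕜) ε z)))
      = ((residual f hf r - residual f hf s : Moderate (ℝ × ℝ) 𝕜) : Par → ℝ × ℝ → 𝕜) := by
  funext ε z
  rw [← residual_apply (hf := hf), ← residual_apply (hf := hf)]
  rfl

variable {L : NNReal}

theorem exists_isWaveSolution (hL : LipschitzWith L f) (hf0 : f 0 = 0) (a b : GenFun ℝ 𝕜)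
    (h : GenFun (ℝ × ℝ) 𝕜) : ∃ u, IsWaveSolution f hf a b h u := by
  obtain ⟨a, rfl⟩ := GenFun.mk_surjective a
  obtain ⟨b, rfl⟩ := GenFun.mk_surjective b
  obtain ⟨h, rfl⟩ := GenFun.mk_surjective h
  -- The classical problem is solved exactly for each `ε`, so the equations hold at the level of
  -- representatives and only moderateness remains.
  choose u su hbox ha hb using fun ε =>
    exists_smooth_solution (a.2.1 ε) (b.2.1 ε) hf.smooth (h.2.1 ε) hL
  have ea : positionFamily u = (a : Par → ℝ → 𝕜) := funext fun ε => funext (ha ε)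
  have eb : velocityFamily u = (b : Par → ℝ → 𝕜) := funext fun ε => funext (hb ε)
  have hu : IsModerate u := isModerate_of_box hf hL hf0 su h.2.1 hbox (ea ▸ a.2.2) (eb ▸ b.2.2) h.2.2
  refine ⟨GenFun.mk ⟨u, su, hu⟩, isWaveSolution_mk_iff.2 ⟨congrArg GenFun.mk ?_,
    congrArg GenFun.mk (Subtype.ext ea), congrArg GenFun.mk (Subtype.ext eb)⟩⟩
  refine Subtype.ext (funext fun ε => funext fun z => ?_)
  rw [residual_apply]
  exact sub_eq_of_eq_add' (hbox ε z)

/-- Stability of generalized solutions in the sharp topologies. -/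
theorem IsWaveSolution.stability (hL : LipschitzWith L f) {a b : GenFun ℝ 𝕜}
    {h u : GenFun (ℝ × ℝ) 𝕜} (hu : IsWaveSolution f hf a b h u) {K : Set (ℝ × ℝ)}
    (hK : IsCompact K) (m p : ℕ) :
    ∃ (T : ℝ) (q : ℕ), ∀ (a' b' : GenFun ℝ 𝕜) (h' u' : GenFun (ℝ × ℝ) 𝕜),
      IsWaveSolution f hf a' b' h' u' → a - a' ∈ sharpNhd (Set.Icc (-T) T) (m + 1) q →
      b - b' ∈ sharpNhd (Set.Icc (-T) T) (m + 1) q → h - h' ∈ sharpNhd (diamond T) m q →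
      u - u' ∈ sharpNhd K m p := by
  obtain ⟨r, rfl⟩ := GenFun.mk_surjective u
  obtain ⟨T, -, hT⟩ := exists_subset_diamond hK
  obtain ⟨q, hq⟩ := SupO.stability hf hL r.2.1 r.2.2 T m p
  refine ⟨T, q, fun a' b' h' u' hu' ha hb hh => ?_⟩
  obtain ⟨s, rfl⟩ := GenFun.mk_surjective u'
  obtain ⟨rfl, rfl, rfl⟩ := isWaveSolution_mk_iff.1 hu
  obtain ⟨rfl, rfl, rfl⟩ := isWaveSolution_mk_iff.1 hu'
  refine ⟨r - s, rfl, fun k hk => SupO.mono_set (hq s s.2.1 ?_ ?_ ?_ k hk) hT⟩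
  · rw [positionFamily_sub]
    exact fun i hi => SupO.of_mk_mem_sharpNhd isCompact_Icc ha hi
  · rw [velocityFamily_sub]
    exact fun i hi => SupO.of_mk_mem_sharpNhd isCompact_Icc hb hi
  · rw [residual_sub (hf := hf)]
    exact fun i hi => SupO.of_mk_mem_sharpNhd (isCompact_diamond T) hh hi

theorem zero_mem_sharpNhd {E : Type*} [NormedAddCommGroup E] [NormedSpace ℝ E] {K : Set E}
    (hK : IsCompact K) (m p : ℕ) : (0 : GenFun E 𝕜) ∈ sharpNhd K m p :=
  ⟨0, GenFun.mk_zero, fun k _ => IsNull.zero K hK k p⟩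

/-- Equal data have difference zero, which lies in every `sharpNhd`; stability then makes the
difference of the solutions small to every order. -/
theorem IsWaveSolution.unique (hL : LipschitzWith L f) {a b : GenFun ℝ 𝕜}
    {h u u' : GenFun (ℝ × ℝ) 𝕜} (hu : IsWaveSolution f hf a b h u)
    (hu' : IsWaveSolution f hf a b h u') : u = u' := by
  obtain ⟨r, rfl⟩ := GenFun.mk_surjective u
  obtain ⟨s, rfl⟩ := GenFun.mk_surjective u'
  refine GenFun.mk_eq_mk.2 fun K hK k p => ?_
  obtain ⟨T, q, hq⟩ := hu.stability hL hK k p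
  have h1 := hq a b h _ hu'
  rw [sub_self, sub_self, sub_self] at h1
  exact SupO.of_mk_mem_sharpNhd (r := r - s) hK (h1 (zero_mem_sharpNhd isCompact_Icc _ _)
    (zero_mem_sharpNhd isCompact_Icc _ _) (zero_mem_sharpNhd (isCompact_diamond T) _ _)) le_rfl

/-- The `T` and `q` from stability depend only on the solution at the base point, so they define one
neighbourhood of the data that works for all solutions nearby. -/
theorem continuous_of_isWaveSolution (hL : LipschitzWith L f)
    {S : GenFun ℝ 𝕜 × GenFun ℝ 𝕜 × GenFun (ℝ × ℝ) 𝕜 → GenFun (ℝ × ℝ) 𝕜}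
    (hS : ∀ a b h, IsWaveSolution f hf a b h (S (a, b, h))) : Continuous S := by
  refine continuous_iff_continuousAt.2 ?_
  rintro ⟨a, b, h⟩ U hU
  obtain ⟨K, m, p, hK, hU⟩ := exists_sharpNhd_of_mem_nhds hU
  obtain ⟨T, q, hq⟩ := (hS a b h).stability hL hK m p
  have e1 := eventually_sub_mem_sharpNhd a (isCompact_Icc (a := -T) (b := T)) (m + 1) q
  have e2 := eventually_sub_mem_sharpNhd b (isCompact_Icc (a := -T) (b := T)) (m + 1) q
  have e3 := eventually_sub_mem_sharpNhd h (isCompact_diamond T) m q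
  refine Filter.mem_map.2 ((e1.prod_nhds (e2.prod_nhds e3)).mono ?_)
  rintro ⟨a', b', h'⟩ ⟨h1, h2, h3⟩
  exact hU _ (hq a' b' h' _ (hS a' b' h') h1 h2 h3)

end WaveProblem

end Colombeau

theorem mainTheorem2 {𝕜 : Type*} [RCLike 𝕜] (f : 𝕜 → 𝕜) (hf : Colombeau.PolyGrowth f)
    (hLip : ∃ L : NNReal, LipschitzWith L f) (hf0 : f 0 = 0) :
    (∀ (a b : Colombeau.GenFun ℝ 𝕜) (h : Colombeau.GenFun (ℝ × ℝ) 𝕜),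
      ∃! u : Colombeau.GenFun (ℝ × ℝ) 𝕜, Colombeau.IsWaveSolution f hf a b h u) ∧
    ∃ S : Colombeau.GenFun ℝ 𝕜 × Colombeau.GenFun ℝ 𝕜 × Colombeau.GenFun (ℝ × ℝ) 𝕜 →
        Colombeau.GenFun (ℝ × ℝ) 𝕜,
      (∀ (a b : Colombeau.GenFun ℝ 𝕜) (h : Colombeau.GenFun (ℝ × ℝ) 𝕜),
        Colombeau.IsWaveSolution f hf a b h (S (a, b, h))) ∧
      Continuous S := by
  obtain ⟨L, hL⟩ := hLip
  refine ⟨fun a b h => ?_, ?_⟩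
  · obtain ⟨u, hu⟩ := Colombeau.exists_isWaveSolution (hf := hf) hL hf0 a b h
    exact ⟨u, hu, fun v hv => hv.unique hL hu⟩
  -- By uniqueness any choice of solutions is the solution map.
  · choose S hS using Colombeau.exists_isWaveSolution (hf := hf) hL hf0
    exact ⟨fun d => S d.1 d.2.1 d.2.2, hS, Colombeau.continuous_of_isWaveSolution hL hS⟩
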